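/- **Language.** Fix a first-order language of arithmetic with $0$, $S$, $=$ and further function and relation symbols, all with a fixed standard interpretation in $\mathbb N$, together with a unary predicate $I$; this is $\mathcal L_0$. A quantifier-free formula is *simple* if it contains no closed terms. $\mathcal L_{n+1}$ adds to $\mathcal L_n$ a $k$-ary Skolem function $c_{\exists x\,\phi}$ for each $\exists x\,\phi(x,y_1,\dots,y_k)$ with $\phi$ a simple quantifier-free formula of $\mathcal L_n$; $\mathcal L_\epsilon$ is the quantifier-free part of $\bigcup_n\mathcal L_n$, and the simple rank $rk_s$ of an expression is the least $n$ such that it lies in $\mathcal L_n$. For $\phi$ simple, $\exists x\,\phi(x,\vec t)$ abbreviates $\phi(c_{\exists x\phi}(\vec t),\vec t)$ and $\forall x\,\phi(x,\vec t)$ abbreviates $\phi(c_{\exists x\neg\phi}(\vec t),\vec t)$; $\phi\to\psi$ abbreviates $\neg\phi\vee\psi$. Fix a simple quantifier-free formula $B(x,y,X)$ of the language of arithmetic in which $X$ occurs, and only positively, and put $A(y,X)=\forall x\,B(x,y,X)$. Fix a finite list $Cr_0,\dots,Cr_N$ of closed critical formulas, each of one of the forms (with $\phi$ simple and $s,t,\vec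 s$ closed): *Pred* $\neg s=0\to\exists x\,s=Sx$; *Epsilon* $\phi(t,\vec s)\to\exists x\,\phi(x,\vec s)$; *Induction* $\phi(0,\vec s)\wedge\neg\phi(t,\vec s)\to\exists x(\phi(x,\vec s)\wedge\neg\phi(Sx,\vec s))$; *Inductive Definition* $A(t,I)\to t\in I$; *Closure* $\forall x(A(x,\phi)\to\phi(x,\vec s))\to\forall x(x\in I\to\phi(x,\vec s))$. **Expressions and ranks.** Canonical expressions are the terms $c(\vec n)$ with $c$ a Skolem function and $\vec n$ numerals, and the formulas $n\in I$. Write $c_n$ for $c_{\exists x\neg B(x,y,I)}(n)$. Ranks are $0<1<2<\dots<\Omega<\Omega+1<\dots$: $rk(n\in I)=rk(c_n)=\Omega$; for other terms $c(\vec n)$, $c=c_{\exists x\phi}$, $rk=rk_s(\phi)+1$ if $\phi$ does not contain $I$ (also not inside indices of Skolem functions), and $rk=\Omega+rk_s(\phi)+2$ if it does. **Substitutions.** An $\epsilon$-substitution $S$ is a partial function on canonical expressions; the values of terms are positive numerals or $?$, those of formulas are $\top$ or $?$. $\overline S$ extends $S$ by the value $?$ everywhere else. Closed terms and formulas are evaluated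 in $S$ with $?$ read as $0$ for terms and as false for formulas; evaluation is undefined if it needs a value outside $\operatorname{dom}S$ (all parts of a formula are evaluated). $S\vDash\phi$ means that $\phi$ evaluates to true in $S$; $S$ decides $\phi$ if $S\vDash\phi$ or $S\vDash\neg\phi$. $F(e,?)$ is a true formula, $F(c_{\exists x\phi}(\vec t),u)=\phi(u,\vec t)\wedge\bigwedge_{v<u}\neg\phi(v,\vec t)$, and $F(n\in I,\top)=A(n,I)$. $S$ is correct if $\overline S\vDash F(e,u)$ for all $(e,u)\in S$; it is computationally inconsistent if $S\vDash\neg F(e,u)$ for some $(e,u)\in S$, or $(c_n,u),(n\in I,\top)\in S$ for some $n$ and $u\ne{?}$; it is solving if $\overline S\vDash Cr_i$ for all $i$. $S^-_\Omega$ consists of the pairs $(c_n,u)$, $u\neq{?}$, and $(n\in I,?)$ in $S$; $S^+_\Omega$ of the pairs $(c_n,?)$ and $(n\in I,\top)$ in $S$. **Sequents.** A sequent $\Theta=(S,P,V,F)$ consists of an $\epsilon$-substitution $S$, a finite sequence $P$ without repetitions enumerating the formulas $n\in I$ with $S(n\in I)=\top$, a function $V$ on the entries of $P$ whose values are finite $\epsilon$-substitutions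 $T$ with $T^-_\Omega=T$, and $F:\{e\in\operatorname{dom}S: S(e)={?}\text{ or }rk(e)=\Omega\}\to\{t,f\}$. $\emptyset$ is the empty sequent. **$H$-step.** For $S\vDash\neg Cr_i$ define $(e_i,v_i)$, where $|s|$ denotes the value of $s$ in $S$: for Pred, $(c_{\exists x\,y=Sx}(|s|),|s|-1)$; for Epsilon, $(c_{\exists x\phi}(|\vec s|),|t|)$; for Induction, $e_i=c_{\exists x(\phi(x)\wedge\neg\phi(Sx))}(|\vec s|)$ and $v_i$ is the least $m<|t|$ with $S\vDash\phi(m,\vec s)$, $S\vDash\neg\phi(m+1,\vec s)$; for Inductive Definition, $(|t|\in I,\top)$; for Closure, let $n\in I$ be the first entry of $P$ with $S\vDash\neg\phi(n,\vec s)$: if $S\vDash\neg A(n,\phi)$ then $e_i=c_n$ and $v_i=S(c_{\exists z\neg B(z,x,\phi)}(n,|\vec s|))$, and if $S\vDash A(n,\phi)$ then $e_i=c_{\exists x\neg(A(x,\phi)\to\phi(x))}(|\vec s|)$ and $v_i=n$. The $H$-step applies to $\Theta$ if $S$ is correct and nonsolving and all calculations take place in $S$, that is: $S$ decides every $Cr_i$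 and every $F(c,u)$ with $(c,u)\in S$ and $c$ a term; every $(e_i,v_i)$ with $S\vDash\neg Cr_i$ is defined by evaluation in $S$ with $v_i$ a positive numeral or $\top$ (in the induction case also deciding the instances needed to find the least $m$, and in the closure case with $\phi(m,\vec s)$ true in $S$ for the earlier entries $m$ of $P$); and, for the pair $(e,v)=(e_i,v_i)$ with $rk(e_i)$ least and $i$ least among these, $(e,?)\in S$; if $e=c_n$ then $n\in I\in\operatorname{dom}S$; if $e$ is $n\in I$ then $c_n\in\operatorname{dom}S$; if $rk(e)=\Omega$, $e$ is a term and $(c_m,?)\in S$ then $m\in I\in\operatorname{dom}S$. Then $H(\Theta)$ is: - if $rk(e)\neq\Omega$: $S$ becomes $(S_{\le rk(e)}\setminus\{(e,?)\})\cup\{(e,v)\}$; $P,V$ are kept if $rk(e)>\Omega$ and become empty if $rk(e)<\Omega$; - if $e$ is $n\in I$: $(S_{<\Omega}\cup S^+_\Omega\setminus\{(e,?)\})\cup\{(e,\top)\}$, $P^\frown\langle n\in I\rangle$, $V\cup\{(n\in I,S^-_\Omega)\}$; - if $e=c_n$: with $P'$ the longest initial segment of $P$ not containing $n\in I$, $S'$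 the set of pairs $(c_m,?),(m\in I,\top)\in S$ with $m\in I$ in $P'$, and $V'=V(n\in I)$ if $n\in I$ is in $P$, $V'=S^-_\Omega$ otherwise: $S_{<\Omega}\cup S'\cup V'\cup\{(c_n,v)\}$, $P'$, $V\upharpoonright P'$; $F$ is kept where it still applies and is $t$ at new expressions. An $e'\in\operatorname{dom}S$ with $rk(e')=rk(e)$ is *active* if its value in $H(\Theta)$ is missing or differs from $S(e')$. **Deductions.** Axioms: *AxF*, $S$ computationally inconsistent; *AxS*, $S$ solving and deciding every $Cr_i$; *AxH*, the $H$-step applies and some active $e'$ has $F(e')=f$. Rules, with conclusion $\Theta$ and main expression $e$ (in all but $H$, $e\notin\operatorname{dom}\Theta$; $(e,\cdot),\Theta$ denotes $\Theta$ with the displayed data added; $u$ ranges over positive numerals): - $Cut_e$ and $CutFr_e$, for a term $e$ with $rk(e)\ne\Omega$: premises $(e,u),\Theta$ for all $u$, and $(e,?,f),\Theta$ for $Cut$, $(e,?,t),\Theta$ for $CutFr$; - $Cut^{\Omega,\mathrm{term}}_e$ and $CutFr^{\Omega,\mathrm{term}}_e$, for a term $e$ with $rk(e)=\Omega$: the same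 with $(e,u,f),\Theta$ in place of $(e,u),\Theta$; - $Cut^{\Omega,\mathrm{form}}_e$, for a formula $e=(n\in I)$: premises $(e,?,f),\Theta$ and $(e,\top,f,P_e,V_e),\Theta$ for all $P_e$ proper for $e,\Theta$ and all $V_e$ on $P_e$ with values as required of $V$. Here $P_e$ is a sequence of distinct formulas $m\in I$ outside $\operatorname{dom}\Theta$, ending in $e$, with $u={?}$ whenever $(c_m,u)\in\Theta$, and such that the concatenation $Q=P^\frown P_e$ is admissible, i.e. $B(0,m,I)$ is true for each entry $m$ of $Q$ when $I$ is the set of earlier entries; the premise gives all entries of $P_e$ the value $\top$ and the label $f$, and appends $P_e$ to $P$ and $V_e$ to $V$; - $Fr_e$: premise $(e,?,t),\Theta$; - $H_{e,v}$: premise $H(\Theta)$, if the $H$-step applies to $\Theta$ with $H$-expression $e$ and value $v$ and $F(e')=t$ for all active $e'$. A derivation is a well-founded tree built from axioms by these rules. It is an *$r$-derivation* if all $Cut$ rules (with their $\Omega$-variants) have main expressions of rank $<r$, there are no $CutFr$ rules, and all $Fr$ and $H$ rules have main expressions of rank $\ge r$. **Theorem.** Let $r\le\Omega$ be a rank and $\Theta$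 a sequent. Suppose there is an $\Omega$-derivation of $\Theta$, and there is a path $\emptyset=\Theta_0,\dots,\Theta_n=\Theta$ in which each $\Theta_{i+1}$ is a premise of an inference with conclusion $\Theta_i$, which is an $H$ or $Fr$ rule of rank $\ge\Omega$ or a $Cut$ rule of rank $\le r$. Then there is an $r$-derivation of $\Theta$. -/

import Mathlib

namespace EpsID

section Expressions

/-! ### The Skolemized language

`L` collects the symbols of the language of arithmetic other than `0`, `S` and `=`, which are built
in; their standard interpretation is an instance `L.Structure ℕ`. -/

mutual
/-- Terms of `ℒ_ε` in the variables `0, …, n-1` in which no closed term occurs, that is, every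
subterm contains a variable. A Skolem function is given by its index, the simple formula
`φ(x, y₁, …, y_k)` of `∃x φ(x, y₁, …, y_k)`; the variable `x` is the variable number `0`. -/
inductive OTm (L : FirstOrder.Language.{0, 0}) : ℕ → Type
  | var {n : ℕ} (i : Fin n) : OTm L n
  | succ {n : ℕ} (t : OTm L n) : OTm L n
  | func {n k : ℕ} (f : L.Functions (k + 1)) (ts : Fin (k + 1) → OTm L n) : OTm L n
  | sk {n k : ℕ} (φ : SFm L (k + 2)) (ts : Fin (k + 1) → OTm L n) : OTm L n
/-- The simple quantifier-free formulas of `ℒ_ε` (those without closed terms) in the variables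
`0, …, n-1`. The atom `mem t` is `t ∈ I`. -/
inductive SFm (L : FirstOrder.Language.{0, 0}) : ℕ → Type
  | eq {n : ℕ} (s t : OTm L n) : SFm L n
  | rel {n k : ℕ} (R : L.Relations k) (ts : Fin k → OTm L n) : SFm L n
  | mem {n : ℕ} (t : OTm L n) : SFm L n
  | not {n : ℕ} (φ : SFm L n) : SFm L n
  | and {n : ℕ} (φ ψ : SFm L n) : SFm L n
  | or {n : ℕ} (φ ψ : SFm L n) : SFm L n
end

/-- The closed terms of `ℒ_ε`. -/
inductive CTm (L : FirstOrder.Language.{0, 0}) : Type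
  | zero : CTm L
  | succ (t : CTm L) : CTm L
  | func {k : ℕ} (f : L.Functions k) (ts : Fin k → CTm L) : CTm L
  | sk {k : ℕ} (φ : SFm L (k + 1)) (ts : Fin k → CTm L) : CTm L

/-- The closed formulas of `ℒ_ε`. -/
inductive CFm (L : FirstOrder.Language.{0, 0}) : Type
  | eq (s t : CTm L) : CFm L
  | rel {k : ℕ} (R : L.Relations k) (ts : Fin k → CTm L) : CFm L
  | mem (t : CTm L) : CFm L
  | not (φ : CFm L) : CFm L
  | and (φ ψ : CFm L) : CFm L
  | or (φ ψ : CFm L) : CFm L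

variable {L : FirstOrder.Language.{0, 0}}

mutual
/-- Simple rank: the least `n` such that the expression belongs to `ℒ_n`. A Skolem function
belongs to `ℒ_{n+1}` exactly if its index belongs to `ℒ_n`. -/
def OTm.rkS {n : ℕ} : OTm L n → ℕ
  | .var _ => 0
  | .succ t => t.rkS
  | .func _ ts => Finset.univ.sup fun i => (ts i).rkS
  | .sk φ ts => max (φ.rkS + 1) (Finset.univ.sup fun i => (ts i).rkS)
/-- Simple rank of a simple formula. -/
def SFm.rkS {n : ℕ} : SFm L n → ℕ
  | .eq s t => max s.rkS t.rkS
  | .rel _ ts => Finset.univ.sup fun i => (ts i).rkS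
  | .mem t => t.rkS
  | .not φ => φ.rkS
  | .and φ ψ => max φ.rkS ψ.rkS
  | .or φ ψ => max φ.rkS ψ.rkS
end

mutual
/-- The term contains the predicate `I`, possibly inside the index of a Skolem function. -/
def OTm.HasI {n : ℕ} : OTm L n → Prop
  | .var _ => False
  | .succ t => t.HasI
  | .func _ ts => ∃ i, (ts i).HasI
  | .sk φ ts => φ.HasI ∨ ∃ i, (ts i).HasI
/-- The formula contains the predicate `I`, possibly inside the index of a Skolem function. -/
def SFm.HasI {n : ℕ} : SFm L n → Prop
  | .eq s t => s.HasI ∨ t.HasI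
  | .rel _ ts => ∃ i, (ts i).HasI
  | .mem _ => True
  | .not φ => φ.HasI
  | .and φ ψ => φ.HasI ∨ ψ.HasI
  | .or φ ψ => φ.HasI ∨ ψ.HasI
end

/-- `SFm.Polar true φ`: the atoms `t ∈ I` of `φ` all occur positively; `SFm.Polar false φ`: they
all occur negatively. -/
def SFm.Polar : {n : ℕ} → Bool → SFm L n → Prop
  | _, _, .eq _ _ => True
  | _, _, .rel _ _ => True
  | _, b, .mem _ => b = true
  | _, b, .not φ => SFm.Polar (!b) φ
  | _, b, .and φ ψ => SFm.Polar b φ ∧ SFm.Polar b ψ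
  | _, b, .or φ ψ => SFm.Polar b φ ∧ SFm.Polar b ψ

/-- Substitution of terms for the variables. -/
def OTm.subst {n m : ℕ} (σ : Fin n → OTm L m) : OTm L n → OTm L m
  | .var i => σ i
  | .succ t => .succ (t.subst σ)
  | .func f ts => .func f fun i => (ts i).subst σ
  | .sk φ ts => .sk φ fun i => (ts i).subst σ

/-- Substitution of terms for the variables and of the formulas `ψ t` for the atoms `t ∈ I`. -/
def SFm.substI {n m : ℕ} (σ : Fin n → OTm L m) (ψ : OTm L m → SFm L m) : SFm L n → SFm L m
  | .eq s t => .eq (s.subst σ) (t.subst σ)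
  | .rel R ts => .rel R fun i => (ts i).subst σ
  | .mem t => ψ (t.subst σ)
  | .not φ => .not (φ.substI σ ψ)
  | .and φ χ => .and (φ.substI σ ψ) (χ.substI σ ψ)
  | .or φ χ => .or (φ.substI σ ψ) (χ.substI σ ψ)

/-- Substitution of terms for the variables of a formula. -/
def SFm.subst {n m : ℕ} (σ : Fin n → OTm L m) (φ : SFm L n) : SFm L m := φ.substI σ .mem

/-- Substitution of closed terms for all variables of a term. -/
def OTm.inst {n : ℕ} (s : Fin n → CTm L) : OTm L n → CTm L
  | .var i => s i
  | .succ t => .succ (t.inst s)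
  | .func f ts => .func f fun i => (ts i).inst s
  | .sk φ ts => .sk φ fun i => (ts i).inst s

/-- Substitution of closed terms for all variables of a formula. -/
def SFm.inst {n : ℕ} (s : Fin n → CTm L) : SFm L n → CFm L
  | .eq t u => .eq (t.inst s) (u.inst s)
  | .rel R ts => .rel R fun i => (ts i).inst s
  | .mem t => .mem (t.inst s)
  | .not φ => .not (φ.inst s)
  | .and φ ψ => .and (φ.inst s) (ψ.inst s)
  | .or φ ψ => .or (φ.inst s) (ψ.inst s)

/-- Implication, as an abbreviation. -/
def SFm.imp {n : ℕ} (φ ψ : SFm L n) : SFm L n := .or (.not φ) ψ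

/-- Implication, as an abbreviation. -/
def CFm.imp (φ ψ : CFm L) : CFm L := .or (.not φ) ψ

/-- The numeral `S⋯S0`. -/
def CTm.num : ℕ → CTm L
  | 0 => .zero
  | n + 1 => .succ (CTm.num n)

/-- A true formula. -/
def CFm.top : CFm L := .eq .zero .zero

/-- Finite conjunction. -/
def CFm.conj (l : List (CFm L)) : CFm L := l.foldr .and .top

/-- `∀x φ(x, y⃗)` with parameters `y⃗`, an abbreviation of `φ(c_{∃x ¬φ}(y⃗), y⃗)`. -/
def SFm.all {k : ℕ} (φ : SFm L (k + 2)) : SFm L (k + 1) :=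
  φ.subst (Fin.cons (.sk (.not φ) .var) .var)

/-- `∀x φ(x, s⃗)` with closed `s⃗`, an abbreviation of `φ(c_{∃x ¬φ}(s⃗), s⃗)`. -/
def SFm.allC {k : ℕ} (φ : SFm L (k + 1)) (s : Fin k → CTm L) : CFm L :=
  φ.inst (Fin.cons (.sk (.not φ) s) s)

/-- `∃x φ(x, s⃗)` with closed `s⃗`, an abbreviation of `φ(c_{∃x φ}(s⃗), s⃗)`. -/
def SFm.exC {k : ℕ} (φ : SFm L (k + 1)) (s : Fin k → CTm L) : CFm L :=
  φ.inst (Fin.cons (.sk φ s) s)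

/-- The formula `A(y, X) = ∀x B(x, y, X)` of the inductive definition, given by its quantifier-free
matrix `B` in the language of arithmetic with the extra predicate `X` (written as `I`).
The variable `x` has number `0`, the variable `y` has number `1`. -/
structure OpForm (L : FirstOrder.Language.{0, 0}) where
  B : SFm L 2
  noSkolem : B.rkS = 0
  positive : B.Polar true
  occurs : B.HasI

variable (O : OpForm L)

/-- The formula `A(y, I)`. -/
def OpForm.A : SFm L 1 := O.B.all

/-- The formula `B(z, x, φ)`, where `φ = φ(x, y⃗)`: its variable `0` is `z`, its variable `1` is `x`,
the others are `y⃗`. -/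
def OpForm.BAt {k : ℕ} (φ : SFm L (k + 1)) : SFm L (k + 2) :=
  O.B.substI ![.var 0, .var 1] fun t => φ.subst (Fin.cons t fun i => .var i.succ.succ)

/-- The formula `A(x, φ) = ∀z B(z, x, φ)`, where `φ = φ(x, y⃗)`. -/
def OpForm.AAt {k : ℕ} (φ : SFm L (k + 1)) : SFm L (k + 1) := (O.BAt φ).all

/-- The formula `A(x, φ) → φ(x)`. -/
def OpForm.step {k : ℕ} (φ : SFm L (k + 1)) : SFm L (k + 1) := (O.AAt φ).imp φ

/-- The formula `y = S x`, where `x` is the variable `0` and `y` the variable `1`. -/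
def predFm : SFm L 2 := .eq (.var 1) (.succ (.var 0))

/-- The formula `φ(x, y⃗) ∧ ¬ φ(S x, y⃗)`. -/
def indFm {k : ℕ} (φ : SFm L (k + 1)) : SFm L (k + 1) :=
  .and φ (.not (φ.subst (Fin.cons (.succ (.var 0)) fun i => .var i.succ)))

/-- Closed critical formulas, presented with the data that they are instances of. -/
inductive Crit (L : FirstOrder.Language.{0, 0}) : Type
  | pred (s : CTm L)
  | eps {k : ℕ} (φ : SFm L (k + 1)) (s : Fin k → CTm L) (t : CTm L)
  | ind {k : ℕ} (φ : SFm L (k + 1)) (s : Fin k → CTm L) (t : CTm L)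
  | indDef (t : CTm L)
  | closure {k : ℕ} (φ : SFm L (k + 1)) (s : Fin k → CTm L)

/-- The critical formula itself. -/
def Crit.fm : Crit L → CFm L
  | .pred s => .imp (.not (.eq s .zero)) (predFm.exC ![s])
  | .eps φ s t => .imp (φ.inst (Fin.cons t s)) (φ.exC s)
  | .ind φ s t =>
      .imp (.and (φ.inst (Fin.cons .zero s)) (.not (φ.inst (Fin.cons t s)))) ((indFm φ).exC s)
  | .indDef t => .imp (O.A.inst ![t]) (.mem t)
  | .closure φ s =>
      .imp ((O.step φ).allC s) ((SFm.imp (.mem (.var 0)) φ).allC s)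

end Expressions

section Substitutions

variable {L : FirstOrder.Language.{0, 0}}

/-! ### Canonical expressions, ranks, ε-substitutions -/

/-- Canonical terms `c_{∃x φ}(n₁, …, n_k)`. -/
structure CanTerm (L : FirstOrder.Language.{0, 0}) where
  k : ℕ
  body : SFm L (k + 1)
  args : Fin k → ℕ

/-- Canonical expressions: canonical terms, and the formulas `n ∈ I`. -/
inductive CExpr (L : FirstOrder.Language.{0, 0}) : Type
  | term (c : CanTerm L)
  | form (n : ℕ)

/-- Ranks: `inlₗ n` is the finite rank `n`, and `inrₗ n` is `Ω + n`. -/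
abbrev Rank := ℕ ⊕ₗ ℕ

/-- The rank `Ω`. -/
def Ω : Rank := Sum.inrₗ 0

/-- The canonical term `c_n = c_{∃x ¬B(x,y,I)}(n)`. -/
def OpForm.cTerm (O : OpForm L) (n : ℕ) : CanTerm L := ⟨1, .not O.B, ![n]⟩

/-- The canonical expression `c_n`. -/
def OpForm.c (O : OpForm L) (n : ℕ) : CExpr L := .term (O.cTerm n)

open Classical in
/-- The rank of a canonical expression. -/
noncomputable def CExpr.rk (O : OpForm L) : CExpr L → Rank
  | .form _ => Ω
  | .term c =>
      if ∃ n, c = O.cTerm n then Ω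
      else if c.body.HasI then Sum.inrₗ (c.body.rkS + 1 + 1)
      else Sum.inlₗ (c.body.rkS + 1)

/-- The possible values of an ε-substitution: `?`, a positive numeral, or `⊤`. -/
inductive Val
  | unk
  | num (u : ℕ+)
  | top

/-- Partial functions from canonical expressions to values. -/
abbrev Subst (L : FirstOrder.Language.{0, 0}) := CExpr L → Option Val

namespace Subst

variable (S : Subst L)

/-- The values of terms are `?` or positive numerals, the values of formulas are `?` or `⊤`. -/
def IsEpsSubst : Prop :=
  (∀ c, S (.term c) ≠ some .top) ∧ ∀ n u, S (.form n) ≠ some (.num u)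

/-- The domain. -/
def dom : Set (CExpr L) := {e | (S e).isSome}

open Classical in
/-- The set of those pairs in `S` which satisfy `p`. -/
noncomputable def filter (p : CExpr L → Val → Prop) : Subst L := fun e =>
  match S e with
  | some u => if p e u then some u else none
  | none => none

open Classical in
/-- The substitution `S` with the value at `e` set to `u`. -/
noncomputable def set (e : CExpr L) (u : Val) : Subst L := Function.update S e (some u)

/-- The union of two substitutions (used where they agree on the common domain). -/
def union (T : Subst L) : Subst L := fun e => (S e).or (T e)

/-- The standard extension: everything undefined gets the value `?`. -/
def ext : Subst L := fun e => some ((S e).getD .unk)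

end Subst

open Classical in
/-- All entries of a finite sequence, if all of them are defined. -/
noncomputable def seqOpt {α : Type} {k : ℕ} (f : Fin k → Option α) : Option (Fin k → α) :=
  if h : ∀ i, (f i).isSome then some fun i => (f i).get (h i) else none

/-- The number which a value stands for: `?` stands for `0`. -/
def Val.toNat? : Val → Option ℕ
  | .unk => some 0
  | .num u => some u
  | .top => none

/-- The truth value which a value stands for: `?` stands for falsity. -/
def Val.toBool? : Val → Option Bool
  | .unk => some false
  | .num _ => none
  | .top => some true

variable [L.Structure ℕ]

/-- `t.eval S = some n` if the reduction `|t|_S` is the numeral `n`; `t.eval S = none` if `|t|_S` is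
not a numeral. -/
noncomputable def CTm.eval (S : Subst L) : CTm L → Option ℕ
  | .zero => some 0
  | .succ t => (t.eval S).map Nat.succ
  | .func f ts => (seqOpt fun i => (ts i).eval S).map (FirstOrder.Language.Structure.funMap f)
  | .sk φ ts =>
      (seqOpt fun i => (ts i).eval S).bind fun a => (S (.term ⟨_, φ, a⟩)).bind Val.toNat?

open Classical in
/-- `φ.eval S = some b` if the reduction `|φ|_S` is a sentence of the language of arithmetic, with
truth value `b` in the standard model; otherwise `φ.eval S = none`. -/
noncomputable def CFm.eval (S : Subst L) : CFm L → Option Bool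
  | .eq s t => (s.eval S).bind fun a => (t.eval S).map fun b => decide (a = b)
  | .rel R ts =>
      (seqOpt fun i => (ts i).eval S).map fun a => decide (FirstOrder.Language.Structure.RelMap R a)
  | .mem t => (t.eval S).bind fun n => (S (.form n)).bind Val.toBool?
  | .not φ => (φ.eval S).map fun a => !a
  | .and φ ψ => (φ.eval S).bind fun a => (ψ.eval S).map fun b => a && b
  | .or φ ψ => (φ.eval S).bind fun a => (ψ.eval S).map fun b => a || b

/-- `S ⊨ φ`. -/
def Subst.Sat (S : Subst L) (φ : CFm L) : Prop := φ.eval S = some true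

/-- `S` decides `φ`. -/
def Subst.Decides (S : Subst L) (φ : CFm L) : Prop := S.Sat φ ∨ S.Sat (.not φ)

variable (O : OpForm L)

/-- The formula `F(e, u)`, which justifies the value `u` of `e`. -/
def FFm : CExpr L → Val → CFm L
  | .term c, .num u =>
      .and (c.body.inst (Fin.cons (.num u) fun i => .num (c.args i)))
        (.conj ((List.range (u : ℕ)).map fun v =>
          .not (c.body.inst (Fin.cons (.num v) fun i => .num (c.args i)))))
  | .form n, .top => O.A.inst ![.num n]
  | _, _ => .top

/-- `S` is correct. -/
def Subst.Correct (S : Subst L) : Prop := ∀ e u, S e = some u → S.ext.Sat (FFm O e u)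

/-- `S` is computationally inconsistent. -/
def Subst.Inconsistent (S : Subst L) : Prop :=
  (∃ e u, S e = some u ∧ S.Sat (.not (FFm O e u))) ∨
    ∃ n u, S (O.c n) = some (.num u) ∧ S (.form n) = some .top

/-- `S` decides `F(c, u)` for all pairs `(c, u)` in `S` such that `c` is a term. -/
def Subst.Computing (S : Subst L) : Prop :=
  ∀ c u, S (.term c) = some u → S.Decides (FFm O (.term c) u)

/-- `S` is solving, for the list `Cr` of critical formulas. -/
def Subst.Solving {N : ℕ} (Cr : Fin (N + 1) → Crit L) (S : Subst L) : Prop :=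
  ∀ i, S.ext.Sat ((Cr i).fm O)

/-- The negative part of rank `Ω`: pairs `(c_n, u)` with `u ≠ ?`, and pairs `(n ∈ I, ?)`. -/
noncomputable def Subst.negΩ (S : Subst L) : Subst L :=
  S.filter fun e u => e.rk O = Ω ∧ match e with
    | .term _ => u ≠ .unk
    | .form _ => u = .unk

/-- The positive part of rank `Ω`: pairs `(c_n, ?)`, and pairs `(n ∈ I, ⊤)`. -/
noncomputable def Subst.posΩ (S : Subst L) : Subst L :=
  S.filter fun e u => e.rk O = Ω ∧ match e with
    | .term _ => u = .unk
    | .form _ => u = .top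

end Substitutions

section Sequents

variable {L : FirstOrder.Language.{0, 0}}

/-! ### Histories and sequents -/

/-- The data of a sequent `(S, P, V, F)`; an entry `n` of `P` is the formula `n ∈ I`. The values
`t`, `f` of `F` are `true` (temporary), `false` (fixed). -/
@[ext]
structure Sequent (L : FirstOrder.Language.{0, 0}) where
  S : Subst L
  P : List ℕ
  V : ℕ → Option (Subst L)
  F : CExpr L → Option Bool

/-- Conditions on the values `V(n ∈ I)` in a substitution history: finite ε-substitutions that
consist of negative expressions of rank `Ω`. -/
def IsRecord (O : OpForm L) (T : Subst L) : Prop :=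
  T.IsEpsSubst ∧ T.dom.Finite ∧ T.negΩ O = T

/-- The data form a sequent: `S` is an ε-substitution, `(P, V)` is a substitution history, `P`
enumerates the formulas with value `⊤`, and `F` is defined exactly on the expressions in the domain
of `S` which have value `?` or rank `Ω`. All rules below, read upwards from a sequent with finite
`S`, lead to such sequents again. -/
structure Sequent.IsSequent (O : OpForm L) (Θ : Sequent L) : Prop where
  eps : Θ.S.IsEpsSubst
  nodup : Θ.P.Nodup
  history : ∀ n, n ∈ Θ.P ↔ Θ.S (.form n) = some .top
  domV : ∀ n, (Θ.V n).isSome ↔ n ∈ Θ.P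
  record : ∀ n T, Θ.V n = some T → IsRecord O T
  domF : ∀ e, (Θ.F e).isSome ↔ ∃ u, Θ.S e = some u ∧ (u = .unk ∨ e.rk O = Ω)

/-- The empty sequent. -/
def Sequent.empty : Sequent L := ⟨fun _ => none, [], fun _ => none, fun _ => none⟩

/-- The substitution `{(n ∈ I, ⊤) : n ∈ P}`. -/
def topSubst (P : List ℕ) : Subst L
  | .term _ => none
  | .form n => if n ∈ P then some .top else none

/-- The sequence `P` is admissible: `B(0, n, I)` is true for each entry `n`, if `I` is interpreted by
the set of the earlier entries. -/
def Admissible [L.Structure ℕ] (O : OpForm L) (P : List ℕ) : Prop :=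
  ∀ P₁ n P₂, P = P₁ ++ n :: P₂ →
    (topSubst P₁ : Subst L).ext.Sat (O.B.inst ![.num 0, .num n])

/-- The sequent `(e, u), Θ`. -/
noncomputable def Sequent.addVal (e : CExpr L) (u : ℕ+) (Θ : Sequent L) : Sequent L :=
  { Θ with S := Θ.S.set e (.num u) }

open Classical in
/-- The sequent `(e, ?, i), Θ`. -/
noncomputable def Sequent.addUnk (e : CExpr L) (i : Bool) (Θ : Sequent L) : Sequent L :=
  { Θ with S := Θ.S.set e .unk, F := Function.update Θ.F e (some i) }

open Classical in
/-- The sequent `(e, u, i), Θ`, for a term `e` of rank `Ω`. -/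
noncomputable def Sequent.addValΩ (e : CExpr L) (u : ℕ+) (i : Bool) (Θ : Sequent L) : Sequent L :=
  { Θ with S := Θ.S.set e (.num u), F := Function.update Θ.F e (some i) }

/-- `Q` is proper for `n ∈ I, Θ`. The entries of `Q` have no value in `Θ` yet, so that the union in
the definition of `(n ∈ I, ⊤, i, Q, W), Θ` is a function. -/
structure Proper [L.Structure ℕ] (O : OpForm L) (Θ : Sequent L) (n : ℕ) (Q : List ℕ) : Prop where
  nodup : Q.Nodup
  unk : ∀ m ∈ Q, ∀ u, Θ.S (O.c m) = some u → u = .unk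
  admissible : Admissible O (Θ.P ++ Q)
  last : Q.getLast? = some n
  disjoint : List.Disjoint Θ.P Q
  fresh : ∀ m ∈ Q, Θ.S (.form m) = none

/-- The sequent `(n ∈ I, ⊤, i, Q, W), Θ`, where `n` is the last entry of `Q`. -/
def Sequent.addTop (i : Bool) (Q : List ℕ) (W : ℕ → Option (Subst L)) (Θ : Sequent L) :
    Sequent L where
  S := Subst.union (topSubst Q) Θ.S
  P := Θ.P ++ Q
  V := fun m => (Θ.V m).or (W m)
  F := fun e => match e with
    | .form m => if m ∈ Q then some i else Θ.F e
    | .term _ => Θ.F e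

end Sequents

section HStep

variable {L : FirstOrder.Language.{0, 0}} [L.Structure ℕ] (O : OpForm L)

/-! ### The `H`-step, computed inside `S` -/

/-- `P₁` is the part of `P` before the first `n` such that `φ(n, s⃗)` is false. -/
def FirstFail (S : Subst L) (P : List ℕ) {k : ℕ} (φ : SFm L (k + 1)) (s : Fin k → CTm L)
    (n : ℕ) : Prop :=
  ∃ P₁ P₂, P = P₁ ++ n :: P₂ ∧ (∀ m ∈ P₁, S.Sat (φ.inst (Fin.cons (.num m) s))) ∧
    S.Sat (.not (φ.inst (Fin.cons (.num n) s)))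

/-- For a critical formula which is false under `S`, the pair of the expression `e` and the value `v`
which would make it true, all calculations taking place in `S`. -/
inductive HPair (S : Subst L) (P : List ℕ) : Crit L → CExpr L → Val → Prop
  | pred (s : CTm L) (n : ℕ) (v : ℕ+) (hs : s.eval S = some n) (hv : (v : ℕ) = n - 1) :
      HPair S P (.pred s) (.term ⟨1, predFm, ![n]⟩) (.num v)
  | eps {k : ℕ} (φ : SFm L (k + 1)) (s : Fin k → CTm L) (t : CTm L) (a : Fin k → ℕ) (v : ℕ+)
      (hs : ∀ i, (s i).eval S = some (a i)) (ht : t.eval S = some (v : ℕ)) :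
      HPair S P (.eps φ s t) (.term ⟨k, φ, a⟩) (.num v)
  | ind {k : ℕ} (φ : SFm L (k + 1)) (s : Fin k → CTm L) (t : CTm L) (a : Fin k → ℕ) (n : ℕ)
      (v : ℕ+) (hs : ∀ i, (s i).eval S = some (a i)) (ht : t.eval S = some n) (hvn : (v : ℕ) < n)
      (h : S.Sat (φ.inst (Fin.cons (.num v) s)))
      (h' : S.Sat (.not (φ.inst (Fin.cons (.num (v + 1)) s))))
      (least : ∀ m < (v : ℕ), S.Sat (.not (.and (φ.inst (Fin.cons (.num m) s))
        (.not (φ.inst (Fin.cons (.num (m + 1)) s)))))) :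
      HPair S P (.ind φ s t) (.term ⟨k, indFm φ, a⟩) (.num v)
  | indDef (t : CTm L) (n : ℕ) (ht : t.eval S = some n) :
      HPair S P (.indDef t) (.form n) .top
  | closureNeg {k : ℕ} (φ : SFm L (k + 1)) (s : Fin k → CTm L) (a : Fin k → ℕ) (n : ℕ) (v : ℕ+)
      (hs : ∀ i, (s i).eval S = some (a i)) (hn : FirstFail S P φ s n)
      (hA : S.Sat (.not ((O.AAt φ).inst (Fin.cons (.num n) s))))
      (hv : S (.term ⟨k + 1, .not (O.BAt φ), Fin.cons n a⟩) = some (.num v)) :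
      HPair S P (.closure φ s) (O.c n) (.num v)
  | closurePos {k : ℕ} (φ : SFm L (k + 1)) (s : Fin k → CTm L) (a : Fin k → ℕ) (v : ℕ+)
      (hs : ∀ i, (s i).eval S = some (a i)) (hn : FirstFail S P φ s v)
      (hA : S.Sat ((O.AAt φ).inst (Fin.cons (.num v) s))) :
      HPair S P (.closure φ s) (.term ⟨k, .not (O.step φ), a⟩) (.num v)

variable {N : ℕ} (Cr : Fin (N + 1) → Crit L)

/-- The `H`-step applies to a sequent with components `S`, `P`, with `H`-expression `e` and
`H`-value `v`: `S` is correct and nonsolving, and all calculations take place in `S`. Among the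
critical formulas that are false, the one with number `i` is used, which has an expression of least
rank, and the least number among those. -/
structure HApplies (S : Subst L) (P : List ℕ) (e : CExpr L) (v : Val) : Prop where
  correct : S.Correct O
  nonsolving : ¬ S.Solving O Cr
  computing : S.Computing O
  decides : ∀ i, S.Decides ((Cr i).fm O)
  pairs : ∀ i, S.Sat (.not ((Cr i).fm O)) → ∃ e' v', HPair O S P (Cr i) e' v'
  main : ∃ i, S.Sat (.not ((Cr i).fm O)) ∧ HPair O S P (Cr i) e v ∧
    ∀ j e' v', S.Sat (.not ((Cr j).fm O)) → HPair O S P (Cr j) e' v' →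
      e.rk O < e'.rk O ∨ (e.rk O = e'.rk O ∧ i ≤ j)
  unk : S e = some .unk
  term : ∀ n, e = O.c n → (S (.form n)).isSome
  form : ∀ n, e = .form n → (S (O.c n)).isSome
  conflict : ∀ n m, e = O.c n → S (O.c m) = some .unk → (S (.form m)).isSome

open Classical in
/-- The components `S`, `P`, `V` of `H(Θ)`, for the `H`-expression `e` and the `H`-value `v`. -/
noncomputable def hData (e : CExpr L) (v : Val) (Θ : Sequent L) :
    Subst L × List ℕ × (ℕ → Option (Subst L)) :=
  if Ω < e.rk O then
    ((Θ.S.filter fun e' _ => e'.rk O ≤ e.rk O).set e v, Θ.P, Θ.V)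
  else if e.rk O < Ω then
    ((Θ.S.filter fun e' _ => e'.rk O ≤ e.rk O).set e v, [], fun _ => none)
  else match e with
    | .form n =>
        ((Subst.union (Θ.S.filter fun e' _ => e'.rk O < Ω) (Θ.S.posΩ O)).set e v,
          Θ.P ++ [n], Function.update Θ.V n (some (Θ.S.negΩ O)))
    | .term c =>
        let n : ℕ := if h : ∃ n, c = O.cTerm n then h.choose else 0
        let P' : List ℕ := Θ.P.takeWhile fun m => m ≠ n
        let S' : Subst L := Θ.S.filter fun e' u => ∃ m ∈ P',
          (e' = O.c m ∧ u = .unk) ∨ (e' = .form m ∧ u = .top)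
        let V' : Subst L := if n ∈ Θ.P then (Θ.V n).getD fun _ => none else Θ.S.negΩ O
        ((Subst.union (Θ.S.filter fun e' _ => e'.rk O < Ω) (Subst.union S' V')).set e v,
          P', fun m => if m ∈ P' then Θ.V m else none)

open Classical in
/-- The sequent `H(Θ)`. Expressions which are new in `H(Θ)` are temporary. -/
noncomputable def hSeq (e : CExpr L) (v : Val) (Θ : Sequent L) : Sequent L where
  S := (hData O e v Θ).1
  P := (hData O e v Θ).2.1
  V := (hData O e v Θ).2.2
  F := fun e' =>
    match (hData O e v Θ).1 e' with
    | none => none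
    | some u => if u = .unk ∨ e'.rk O = Ω then some ((Θ.F e').getD true) else none

/-- `e'` is active at `Θ`, where `e` is the `H`-expression and `v` the `H`-value. -/
def Active (e : CExpr L) (v : Val) (Θ : Sequent L) (e' : CExpr L) : Prop :=
  e' ∈ Θ.S.dom ∧ e'.rk O = e.rk O ∧ (hSeq O e v Θ).S e' ≠ Θ.S e'

end HStep

section Deductions

variable {L : FirstOrder.Language.{0, 0}} [L.Structure ℕ] (O : OpForm L) {N : ℕ} (Cr : Fin (N + 1) → Crit L)

/-! ### The deduction system -/

/-- The axioms. -/
inductive IsAxiom (Θ : Sequent L) : Prop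
  | axF (h : Θ.S.Inconsistent O)
  | axS (h : Θ.S.Solving O Cr) (h' : ∀ i, Θ.S.Decides ((Cr i).fm O))
  | axH (e : CExpr L) (v : Val) (h : HApplies O Cr Θ.S Θ.P e v) (e' : CExpr L)
      (active : Active O e v Θ e') (fixed : Θ.F e' = some false)

/-- The kinds of rules; the variants of `Cut` and `CutFr` at rank `Ω` are of the same kind. -/
inductive Kind
  | cut
  | cutFr
  | fr
  | h

/-- `Inference O Cr X e Θ Pr`: there is an inference by a rule of kind `X` with main expression `e`,
with conclusion `Θ` and set of premises `Pr`. -/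
inductive Inference : Kind → CExpr L → Sequent L → Set (Sequent L) → Prop
  | cut (c : CanTerm L) (Θ : Sequent L) (hr : (CExpr.term c).rk O ≠ Ω)
      (hc : .term c ∉ Θ.S.dom) :
      Inference .cut (.term c) Θ
        ({Θ.addUnk (.term c) false} ∪ Set.range fun u : ℕ+ => Θ.addVal (.term c) u)
  | cutFr (c : CanTerm L) (Θ : Sequent L) (hr : (CExpr.term c).rk O ≠ Ω)
      (hc : .term c ∉ Θ.S.dom) :
      Inference .cutFr (.term c) Θ
        ({Θ.addUnk (.term c) true} ∪ Set.range fun u : ℕ+ => Θ.addVal (.term c) u)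
  | cutTerm (c : CanTerm L) (Θ : Sequent L) (hr : (CExpr.term c).rk O = Ω)
      (hc : .term c ∉ Θ.S.dom) :
      Inference .cut (.term c) Θ
        ({Θ.addUnk (.term c) false} ∪ Set.range fun u : ℕ+ => Θ.addValΩ (.term c) u false)
  | cutFrTerm (c : CanTerm L) (Θ : Sequent L) (hr : (CExpr.term c).rk O = Ω)
      (hc : .term c ∉ Θ.S.dom) :
      Inference .cutFr (.term c) Θ
        ({Θ.addUnk (.term c) true} ∪ Set.range fun u : ℕ+ => Θ.addValΩ (.term c) u false)
  | cutForm (n : ℕ) (Θ : Sequent L) (hn : .form n ∉ Θ.S.dom) :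
      Inference .cut (.form n) Θ
        ({Θ.addUnk (.form n) false} ∪
          {Θ' | ∃ (Q : List ℕ) (W : ℕ → Option (Subst L)), Proper O Θ n Q ∧
            (∀ m, (W m).isSome ↔ m ∈ Q) ∧ (∀ m T, W m = some T → IsRecord O T) ∧
            Θ' = Θ.addTop false Q W})
  | fr (e : CExpr L) (Θ : Sequent L) (he : e ∉ Θ.S.dom) :
      Inference .fr e Θ {Θ.addUnk e true}
  | h (e : CExpr L) (v : Val) (Θ : Sequent L) (happ : HApplies O Cr Θ.S Θ.P e v)
      (temp : ∀ e', Active O e v Θ e' → Θ.F e' = some true) :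
      Inference .h e Θ {hSeq O e v Θ}

/-- Deductions from the set `𝒮` of sequents: well-founded trees. -/
inductive Deduction (𝒮 : Set (Sequent L)) : Sequent L → Type
  | hyp (Θ : Sequent L) (h : Θ ∈ 𝒮) : Deduction 𝒮 Θ
  | ax (Θ : Sequent L) (h : IsAxiom O Cr Θ) : Deduction 𝒮 Θ
  | inf (X : Kind) (e : CExpr L) (Θ : Sequent L) (Pr : Set (Sequent L))
      (h : Inference O Cr X e Θ Pr) (d : ∀ Θ' ∈ Pr, Deduction 𝒮 Θ') : Deduction 𝒮 Θ

/-- Derivations: deductions from the empty set. -/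
abbrev Derivation (Θ : Sequent L) : Type := Deduction O Cr ∅ Θ

variable {O Cr}

/-- The main expression of every application of a rule of kind `X` in the deduction has a rank
satisfying `p`. -/
def Deduction.Ranks {𝒮 : Set (Sequent L)} (X : Kind) (p : Rank → Prop) :
    {Θ : Sequent L} → Deduction O Cr 𝒮 Θ → Prop
  | _, .hyp _ _ => True
  | _, .ax _ _ => True
  | _, .inf Y e _ Pr _ d =>
      (Y = X → p (e.rk O)) ∧ ∀ Θ' (h : Θ' ∈ Pr), (d Θ' h).Ranks X p

/-- The deduction is an `r`-deduction: `Cut(d) < r`, `CutFr(d) < 0`, `Fr(d) ≥ r`, `H(d) ≥ r`. -/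
structure Deduction.IsRDeduction (r : Rank) {𝒮 : Set (Sequent L)} {Θ : Sequent L}
    (d : Deduction O Cr 𝒮 Θ) : Prop where
  cut : d.Ranks .cut (· < r)
  cutFr : d.Ranks .cutFr (· < Sum.inlₗ 0)
  fr : d.Ranks .fr (r ≤ ·)
  h : d.Ranks .h (r ≤ ·)

variable (O Cr)

/-- `Θ'` is a premise of an inference with conclusion `Θ`, by an `H` or `Fr` rule of rank `≥ Ω` or a
`Cut` rule of rank `≤ r`. -/
def PathStep (r : Rank) (Θ Θ' : Sequent L) : Prop :=
  ∃ X e Pr, Inference O Cr X e Θ Pr ∧ Θ' ∈ Pr ∧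
    match X with
    | .cut => e.rk O ≤ r
    | .cutFr => False
    | .fr => Ω ≤ e.rk O
    | .h => Ω ≤ e.rk O

/-- There is a path `∅ = Θ₀, …, Θ_n = Θ` that consists of `H` and `Fr` rules of rank `≥ Ω` and of
`Cut` rules of rank `≤ r`. -/
def HasPath (r : Rank) (Θ : Sequent L) : Prop :=
  ∃ (n : ℕ) (Θs : ℕ → Sequent L), Θs 0 = Sequent.empty ∧ Θs n = Θ ∧
    ∀ i < n, PathStep O Cr r (Θs i) (Θs (i + 1))

end Deductions

end EpsID

/-! Starting from an `Ω`-derivation, the bound on the ranks of cuts is lowered from `n + 1` to `n`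
as long as necessary. A cut of rank `n` with main expression `e` becomes an `Fr` rule, so that the
label of `e` turns from fixed (`f`) into temporary (`t`). Branches that ended in *AxH* because `e`
is fixed now have to be continued: the `H` rule becomes applicable, and it replaces the value `?`
of `e` by a positive numeral `v`, while it forgets all expressions of higher rank. Cuts of rank
less than `n` decide `F(e, v)`. If it is false, *AxF* applies. If it is true, one returns to the
conclusion `Θ` of the eliminated cut by repeating the `Fr` and `H` rules of rank greater than `n`
on the path from the empty sequent to `Θ`, and continues with the derivation of the premise
`(e, v), Θ`. The sequents met on the way differ from those of the given derivation in their parts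
of rank at most `n`, so the induction on that derivation generalizes over these parts. -/

namespace EpsID

variable {L : FirstOrder.Language.{0, 0}} {O : OpForm L}

section Ranks

theorem inl_lt_Ω (n : ℕ) : (Sum.inlₗ n : Rank) < Ω := Sum.Lex.inl_lt_inr n 0

theorem exists_eq_inl_of_lt_Ω {q : Rank} (h : q < Ω) : ∃ n, q = Sum.inlₗ n := by
  rcases q with n | n
  · exact ⟨n, rfl⟩
  · exact absurd (Sum.Lex.inr_lt_inr_iff.1 h) n.not_lt_zero

theorem lt_inl_succ {q : Rank} {n : ℕ} : q < Sum.inlₗ (n + 1) ↔ q ≤ Sum.inlₗ n := by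
  refine ⟨fun h => ?_, fun h => h.trans_lt (Sum.Lex.inl_lt_inl_iff.2 n.lt_succ_self)⟩
  obtain ⟨m, rfl⟩ := exists_eq_inl_of_lt_Ω (h.trans (inl_lt_Ω _))
  exact Sum.Lex.inl_le_inl_iff.2 (Nat.lt_succ_iff.1 (Sum.Lex.inl_lt_inl_iff.1 h))

theorem inl_succ_le {q : Rank} {n : ℕ} : Sum.inlₗ (n + 1) ≤ q ↔ Sum.inlₗ n < q := by
  rw [← not_lt, lt_inl_succ, not_le]

theorem not_lt_inl_zero (q : Rank) : ¬ q < Sum.inlₗ 0 := fun h => by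
  obtain ⟨m, rfl⟩ := exists_eq_inl_of_lt_Ω (h.trans (inl_lt_Ω 0))
  exact m.not_lt_zero (Sum.Lex.inl_lt_inl_iff.1 h)

instance : WellFoundedLT Rank := ⟨Sum.lex_wf wellFounded_lt wellFounded_lt⟩

theorem rk_c (O : OpForm L) (n : ℕ) : (O.c n).rk O = Ω := by
  unfold OpForm.c CExpr.rk
  exact if_pos ⟨n, rfl⟩

theorem rk_term_of_not_hasI {c : CanTerm L} (h : ¬ c.body.HasI) :
    (CExpr.term c).rk O = Sum.inlₗ (c.body.rkS + 1) := by
  unfold CExpr.rk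
  dsimp only
  rw [if_neg, if_neg h]
  rintro ⟨n, rfl⟩
  exact h O.occurs

theorem not_hasI_of_rk_lt_Ω {c : CanTerm L} (h : (CExpr.term c).rk O < Ω) : ¬ c.body.HasI := by
  intro hI
  unfold CExpr.rk at h
  simp only [hI, if_true] at h
  split_ifs at h
  · exact h.false
  · exact Nat.not_lt_zero _ (Sum.Lex.inr_lt_inr_iff.1 h)

theorem exists_eq_term_of_rk_ne_Ω {e : CExpr L} (h : e.rk O ≠ Ω) : ∃ c, e = .term c := by
  cases e with
  | term c => exact ⟨c, rfl⟩
  | form m => exact absurd rfl h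

end Ranks

section Over

/-- Every canonical expression whose value may be looked up when the closed term is evaluated, in
whatever substitution, belongs to `E`. -/
def CTm.Over (E : Set (CExpr L)) : CTm L → Prop
  | .zero => True
  | .succ t => t.Over E
  | .func _ ts => ∀ i, (ts i).Over E
  | .sk φ ts => (∀ a, .term ⟨_, φ, a⟩ ∈ E) ∧ ∀ i, (ts i).Over E

/-- Every canonical expression whose value may be looked up when the closed formula is evaluated,
in whatever substitution, belongs to `E`. -/
def CFm.Over (E : Set (CExpr L)) : CFm L → Prop
  | .eq s t => s.Over E ∧ t.Over E
  | .rel _ ts => ∀ i, (ts i).Over E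
  | .mem t => (∀ n, .form n ∈ E) ∧ t.Over E
  | .not φ => φ.Over E
  | .and φ ψ => φ.Over E ∧ ψ.Over E
  | .or φ ψ => φ.Over E ∧ ψ.Over E

variable {E : Set (CExpr L)}

theorem CTm.over_univ (t : CTm L) : t.Over Set.univ := by
  induction t with
  | zero => trivial
  | succ _ ih => exact ih
  | func _ _ ih => exact ih
  | sk _ _ ih => exact ⟨fun _ => trivial, ih⟩

theorem CFm.over_univ (φ : CFm L) : φ.Over Set.univ := by
  induction φ with
  | eq s t => exact ⟨s.over_univ, t.over_univ⟩
  | rel _ ts => exact fun i => (ts i).over_univ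
  | mem t => exact ⟨fun _ => trivial, t.over_univ⟩
  | not _ ih => exact ih
  | and _ _ ih ih' => exact ⟨ih, ih'⟩
  | or _ _ ih ih' => exact ⟨ih, ih'⟩

theorem CTm.over_num (n : ℕ) : (CTm.num n).Over E := by
  induction n with
  | zero => trivial
  | succ _ ih => exact ih

theorem CFm.over_top : (CFm.top : CFm L).Over E := ⟨trivial, trivial⟩

theorem CFm.over_conj (l : List (CFm L)) (h : ∀ φ ∈ l, φ.Over E) : (CFm.conj l).Over E := by
  induction l with
  | nil => exact CFm.over_top
  | cons φ l ih => exact ⟨h φ List.mem_cons_self, ih fun ψ hψ => h ψ (List.mem_cons_of_mem _ hψ)⟩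

mutual
theorem OTm.inst_subst {n m : ℕ} (σ : Fin n → OTm L m) (s : Fin m → CTm L) :
    ∀ t : OTm L n, (t.subst σ).inst s = t.inst fun i => (σ i).inst s
  | .var _ => rfl
  | .succ t => congrArg CTm.succ (OTm.inst_subst σ s t)
  | .func f ts => congrArg (CTm.func f) (funext fun i => OTm.inst_subst σ s (ts i))
  | .sk φ ts => congrArg (CTm.sk φ) (funext fun i => OTm.inst_subst σ s (ts i))
end

theorem SFm.inst_subst : ∀ {n m : ℕ} (σ : Fin n → OTm L m) (s : Fin m → CTm L)
    (φ : SFm L n), (φ.subst σ).inst s = φ.inst fun i => (σ i).inst s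
  | _, _, σ, s, .eq t u => congrArg₂ CFm.eq (t.inst_subst σ s) (u.inst_subst σ s)
  | _, _, σ, s, .rel R ts => congrArg (CFm.rel R) (funext fun i => (ts i).inst_subst σ s)
  | _, _, σ, s, .mem t => congrArg CFm.mem (t.inst_subst σ s)
  | _, _, σ, s, .not φ => congrArg CFm.not (φ.inst_subst σ s)
  | _, _, σ, s, .and φ ψ => congrArg₂ CFm.and (φ.inst_subst σ s) (ψ.inst_subst σ s)
  | _, _, σ, s, .or φ ψ => congrArg₂ CFm.or (φ.inst_subst σ s) (ψ.inst_subst σ s)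

theorem OTm.over_inst {n : ℕ} {s : Fin n → CTm L} (hs : ∀ i, (s i).Over E) :
    ∀ t : OTm L n,
      (∀ c, c.body.rkS < t.rkS → (c.body.HasI → t.HasI) → .term c ∈ E) → (t.inst s).Over E
  | .var i, _ => hs i
  | .succ t, hE => OTm.over_inst hs t hE
  | .func f ts, hE => fun i => OTm.over_inst hs (ts i) fun c hc hI =>
      hE c (hc.trans_le (Finset.le_sup (f := fun i => (ts i).rkS) (Finset.mem_univ i)))
        fun h => ⟨i, hI h⟩
  | .sk φ ts, hE => by
      refine ⟨fun a => hE _ (lt_max_of_lt_left φ.rkS.lt_succ_self) Or.inl, fun i => ?_⟩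
      refine OTm.over_inst hs (ts i) fun c hc hI => hE c ?_ fun h => Or.inr ⟨i, hI h⟩
      exact lt_max_of_lt_right
        (hc.trans_le (Finset.le_sup (f := fun i => (ts i).rkS) (Finset.mem_univ i)))

theorem SFm.over_inst : ∀ {n : ℕ} {s : Fin n → CTm L} (_ : ∀ i, (s i).Over E) (φ : SFm L n),
    (∀ c, c.body.rkS < φ.rkS → (c.body.HasI → φ.HasI) → .term c ∈ E) →
      (φ.HasI → ∀ n, .form n ∈ E) → (φ.inst s).Over E
  | _, _, hs, .eq t u, hE, _ =>
      ⟨t.over_inst hs fun c hc hI => hE c (lt_max_of_lt_left hc) fun h => Or.inl (hI h),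
        u.over_inst hs fun c hc hI => hE c (lt_max_of_lt_right hc) fun h => Or.inr (hI h)⟩
  | _, _, hs, .rel _ ts, hE, _ => fun i => (ts i).over_inst hs fun c hc hI =>
      hE c (hc.trans_le (Finset.le_sup (f := fun i => (ts i).rkS) (Finset.mem_univ i)))
        fun h => ⟨i, hI h⟩
  | _, _, hs, .mem t, hE, hE' =>
      ⟨hE' trivial, t.over_inst hs fun c hc _ => hE c hc fun _ => trivial⟩
  | _, _, hs, .not φ, hE, hE' => SFm.over_inst hs φ hE hE'
  | _, _, hs, .and φ ψ, hE, hE' =>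
      ⟨SFm.over_inst hs φ (fun c hc hI => hE c (lt_max_of_lt_left hc) fun h => Or.inl (hI h))
          fun h => hE' (Or.inl h),
        SFm.over_inst hs ψ (fun c hc hI => hE c (lt_max_of_lt_right hc) fun h => Or.inr (hI h))
          fun h => hE' (Or.inr h)⟩
  | _, _, hs, .or φ ψ, hE, hE' =>
      ⟨SFm.over_inst hs φ (fun c hc hI => hE c (lt_max_of_lt_left hc) fun h => Or.inl (hI h))
          fun h => hE' (Or.inl h),
        SFm.over_inst hs ψ (fun c hc hI => hE c (lt_max_of_lt_right hc) fun h => Or.inr (hI h))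
          fun h => hE' (Or.inr h)⟩

theorem FFm_term_over {c : CanTerm L} (h : (CExpr.term c).rk O < Ω) (u : Val) :
    (FFm O (.term c) u).Over {e | e.rk O < (CExpr.term c).rk O} := by
  have hI := not_hasI_of_rk_lt_Ω h
  have over_body (v : ℕ) : (c.body.inst (Fin.cons (.num v) fun i => .num (c.args i))).Over
      {e | e.rk O < (CExpr.term c).rk O} := by
    refine SFm.over_inst (Fin.cases (CTm.over_num v) fun i => CTm.over_num _) _
      (fun c' hlt hI' => ?_) fun h => absurd h hI
    rw [Set.mem_ofPred_eq, rk_term_of_not_hasI hI, rk_term_of_not_hasI (mt hI' hI)]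
    exact Sum.Lex.inl_lt_inl_iff.2 (Nat.succ_lt_succ hlt)
  cases u with
  | num u =>
    refine ⟨over_body u, CFm.over_conj _ fun φ hφ => ?_⟩
    obtain ⟨v, -, rfl⟩ := List.mem_map.1 hφ
    exact over_body v
  | unk => exact CFm.over_top
  | top => exact CFm.over_top

theorem A_inst_over (O : OpForm L) (n : ℕ) :
    (O.A.inst ![.num n]).Over {e | e.rk O = Ω} := by
  have over_arg (i : Fin 1) : ((![.num n] : Fin 1 → CTm L) i).Over {e | e.rk O = Ω} := by
    rw [Subsingleton.elim i 0]
    exact CTm.over_num n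
  have rk_sk (a : Fin 1 → ℕ) : (CExpr.term ⟨1, .not O.B, a⟩).rk O = Ω := by
    convert rk_c O (a 0)
    unfold OpForm.c OpForm.cTerm
    congr with i
    rw [Subsingleton.elim i 0]
    rfl
  unfold OpForm.A SFm.all
  rw [SFm.inst_subst]
  refine SFm.over_inst (Fin.cases ⟨rk_sk, over_arg⟩ over_arg) _ (fun c hc => ?_) fun _ _ => rfl
  exact absurd hc (O.noSkolem ▸ Nat.not_lt_zero _)

end Over

section Evaluation

/-- `S'` has the values of `S` on the part of the domain of `S` that lies in `E`. -/
def Subst.LeOn (E : Set (CExpr L)) (S S' : Subst L) : Prop :=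
  ∀ e ∈ E, ∀ u, S e = some u → S' e = some u

/-- The ε-substitution `S'` extends `S`. -/
def Subst.Le (S S' : Subst L) : Prop := ∀ e u, S e = some u → S' e = some u

theorem Subst.Le.refl (S : Subst L) : S.Le S := fun _ _ h => h

theorem Subst.Le.trans {S S' S'' : Subst L} (h : S.Le S') (h' : S'.Le S'') : S.Le S'' :=
  fun e u he => h' e u (h e u he)

theorem Subst.Le.leOn {S S' : Subst L} (h : S.Le S') (E : Set (CExpr L)) : S.LeOn E S' :=
  fun e _ u => h e u

theorem Subst.le_ext (S : Subst L) : S.Le S.ext := fun e u h => by simp [Subst.ext, h]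

theorem Subst.set_self (S : Subst L) (e : CExpr L) (u : Val) : S.set e u e = some u := by
  classical exact Function.update_self ..

theorem Subst.set_of_ne {e e' : CExpr L} (h : e' ≠ e) (S : Subst L) (u : Val) :
    S.set e u e' = S e' := by
  classical exact Function.update_of_ne h ..

theorem Subst.le_set {S : Subst L} {e : CExpr L} (he : S e = none) (u : Val) :
    S.Le (S.set e u) := fun e' v h => by
  have hne : e' ≠ e := by
    rintro rfl
    simp [he] at h
  rw [Subst.set_of_ne hne, h]

theorem Subst.notMem_dom {S : Subst L} {e : CExpr L} : e ∉ S.dom ↔ S e = none := by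
  simp [Subst.dom]

theorem Subst.ne_of_mem_dom {S : Subst L} {e e' : CExpr L} (hn : S e = none) (he' : e' ∈ S.dom) :
    e' ≠ e := by
  rintro rfl
  exact Subst.notMem_dom.2 hn he'

theorem Subst.mem_dom_set {S : Subst L} {e e' : CExpr L} {u : Val} :
    e' ∈ (S.set e u).dom ↔ e' = e ∨ e' ∈ S.dom := by
  by_cases h : e' = e
  · simp [Subst.dom, h, Subst.set_self]
  · simp [Subst.dom, h, Subst.set_of_ne h]

theorem Subst.LeOn.set {E : Set (CExpr L)} {S S' : Subst L} {e : CExpr L} {u : Val}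
    (h : S.LeOn E S') (hu : S' e = some u) : (S.set e u).LeOn E S' := fun e' he' u' hu' => by
  by_cases hne : e' = e
  · subst hne
    exact hu.trans ((Subst.set_self ..).symm.trans hu')
  · exact h e' he' u' ((Subst.set_of_ne hne _ _).symm.trans hu')

theorem seqOpt_eq_some {α : Type} {k : ℕ} {f : Fin k → Option α} {a : Fin k → α} :
    seqOpt f = some a ↔ ∀ i, f i = some (a i) := by
  unfold seqOpt
  split_ifs with h
  · rw [Option.some_inj, funext_iff]
    exact forall_congr' fun i => by rw [← Option.some_inj, Option.some_get]
  · simp only [false_iff]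
    exact fun H => h fun i => Option.isSome_of_eq_some (H i)

variable [L.Structure ℕ]

theorem CTm.eval_mono {S S' : Subst L} {E : Set (CExpr L)} (h : S.LeOn E S') {t : CTm L}
    (ht : t.Over E) {n : ℕ} (hn : t.eval S = some n) : t.eval S' = some n := by
  induction t generalizing n with
  | zero => exact hn
  | succ t ih =>
    simp only [CTm.eval, Option.map_eq_some_iff] at hn ⊢
    obtain ⟨m, hm, rfl⟩ := hn
    exact ⟨m, ih ht hm, rfl⟩
  | func f ts ih =>
    simp only [CTm.eval, Option.map_eq_some_iff, seqOpt_eq_some] at hn ⊢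
    obtain ⟨a, ha, rfl⟩ := hn
    exact ⟨a, fun i => ih i (ht i) (ha i), rfl⟩
  | sk φ ts ih =>
    simp only [CTm.eval, Option.bind_eq_some_iff, seqOpt_eq_some] at hn ⊢
    obtain ⟨a, ha, u, hu, hn⟩ := hn
    exact ⟨a, fun i => ih i (ht.2 i) (ha i), u, h _ (ht.1 a) _ hu, hn⟩

theorem CFm.eval_mono {S S' : Subst L} {E : Set (CExpr L)} (h : S.LeOn E S') {φ : CFm L}
    (hφ : φ.Over E) {b : Bool} (hb : φ.eval S = some b) : φ.eval S' = some b := by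
  induction φ generalizing b with
  | eq s t =>
    simp only [CFm.eval, Option.bind_eq_some_iff, Option.map_eq_some_iff] at hb ⊢
    obtain ⟨m, hm, n, hn, rfl⟩ := hb
    exact ⟨m, CTm.eval_mono h hφ.1 hm, n, CTm.eval_mono h hφ.2 hn, rfl⟩
  | rel R ts =>
    simp only [CFm.eval, Option.map_eq_some_iff, seqOpt_eq_some] at hb ⊢
    obtain ⟨a, ha, rfl⟩ := hb
    exact ⟨a, fun i => CTm.eval_mono h (hφ i) (ha i), rfl⟩
  | mem t =>
    simp only [CFm.eval, Option.bind_eq_some_iff] at hb ⊢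
    obtain ⟨n, hn, u, hu, hb⟩ := hb
    exact ⟨n, CTm.eval_mono h hφ.2 hn, u, h _ (hφ.1 n) _ hu, hb⟩
  | not φ ih =>
    simp only [CFm.eval, Option.map_eq_some_iff] at hb ⊢
    obtain ⟨a, ha, rfl⟩ := hb
    exact ⟨a, ih hφ ha, rfl⟩
  | and φ ψ ih ih' =>
    simp only [CFm.eval, Option.bind_eq_some_iff, Option.map_eq_some_iff] at hb ⊢
    obtain ⟨a, ha, c, hc, rfl⟩ := hb
    exact ⟨a, ih hφ.1 ha, c, ih' hφ.2 hc, rfl⟩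
  | or φ ψ ih ih' =>
    simp only [CFm.eval, Option.bind_eq_some_iff, Option.map_eq_some_iff] at hb ⊢
    obtain ⟨a, ha, c, hc, rfl⟩ := hb
    exact ⟨a, ih hφ.1 ha, c, ih' hφ.2 hc, rfl⟩

namespace Subst.Le

variable {S S' : Subst L} (hS : S.Le S')
include hS

theorem evalTm {t : CTm L} {n : ℕ} (h : t.eval S = some n) : t.eval S' = some n :=
  CTm.eval_mono (hS.leOn _) t.over_univ h

theorem evalFm {φ : CFm L} {b : Bool} (h : φ.eval S = some b) : φ.eval S' = some b :=
  CFm.eval_mono (hS.leOn _) φ.over_univ h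

theorem sat {φ : CFm L} (h : S.Sat φ) : S'.Sat φ := hS.evalFm h

theorem decides {φ : CFm L} (h : S.Decides φ) : S'.Decides φ := h.imp hS.sat hS.sat

end Subst.Le

theorem Subst.sat_not_iff {S : Subst L} {φ : CFm L} : S.Sat (.not φ) ↔ φ.eval S = some false := by
  simp [Subst.Sat, CFm.eval]

theorem Subst.Sat.not_sat_not {S : Subst L} {φ : CFm L} (h : S.Sat φ) : ¬ S.Sat (.not φ) := by
  rw [Subst.sat_not_iff, show φ.eval S = some true from h]
  simp

theorem Subst.sat_and_iff {S : Subst L} {φ ψ : CFm L} :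
    S.Sat (.and φ ψ) ↔ S.Sat φ ∧ S.Sat ψ := by
  simp only [Subst.Sat, CFm.eval, Option.bind_eq_some_iff, Option.map_eq_some_iff,
    Bool.and_eq_true]
  aesop

theorem Subst.decides_iff {S : Subst L} {φ : CFm L} : S.Decides φ ↔ ∃ b, φ.eval S = some b := by
  rw [Subst.Decides, Subst.sat_not_iff, Subst.Sat]
  exact ⟨fun h => h.elim (⟨_, ·⟩) (⟨_, ·⟩), fun ⟨b, h⟩ => by cases b <;> simp [h]⟩

theorem Subst.Decides.sat_iff_of_le {S S' : Subst L} {φ : CFm L} (h : S.Decides φ)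
    (hS : S.Le S') : S'.Sat φ ↔ S.Sat φ :=
  ⟨fun hs => h.resolve_right fun hn => hs.not_sat_not (hS.sat hn), hS.sat⟩

theorem Subst.Decides.sat_not_iff_of_le {S S' : Subst L} {φ : CFm L} (h : S.Decides φ)
    (hS : S.Le S') : S'.Sat (.not φ) ↔ S.Sat (.not φ) :=
  ⟨fun hn => h.resolve_left fun hs => (hS.sat hs).not_sat_not hn, hS.sat⟩

theorem Subst.sat_top (S : Subst L) : S.Sat .top := by
  simp [Subst.Sat, CFm.top, CFm.eval, CTm.eval]

theorem Subst.sat_FFm_unk (S : Subst L) (e : CExpr L) : S.Sat (FFm O e .unk) := by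
  cases e <;> exact S.sat_top

theorem Subst.sat_FFm {S : Subst L} (h : S.Correct O) (h' : S.Computing O)
    {c : CanTerm L} {u : Val} (hu : S (.term c) = some u) : S.Sat (FFm O (.term c) u) :=
  ((h' c u hu).sat_iff_of_le S.le_ext).1 (h _ _ hu)

theorem Subst.Sat.FFm_of_leOn {S S' : Subst L} {c : CanTerm L} {u : Val}
    (hs : S.Sat (FFm O (.term c) u)) (hc : (CExpr.term c).rk O < Ω)
    (h : S.LeOn {e | e.rk O < (CExpr.term c).rk O} S') : S'.Sat (FFm O (.term c) u) :=
  CFm.eval_mono h (FFm_term_over hc u) hs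

theorem Subst.Inconsistent.mono {S S' : Subst L} (hS : S.Le S') (h : S.Inconsistent O) :
    S'.Inconsistent O :=
  h.imp (fun ⟨e, u, hu, hs⟩ => ⟨e, u, hS _ _ hu, hS.sat hs⟩)
    fun ⟨m, u, h, h'⟩ => ⟨m, u, hS _ _ h, hS _ _ h'⟩

theorem Subst.Solving.sat {N : ℕ} {Cr : Fin (N + 1) → Crit L} {S : Subst L}
    (h : S.Solving O Cr) (h' : ∀ i, S.Decides ((Cr i).fm O)) (i : Fin (N + 1)) :
    S.Sat ((Cr i).fm O) :=
  ((h' i).sat_iff_of_le S.le_ext).1 (h i)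

end Evaluation

section Pairs

variable [L.Structure ℕ]

section FirstFail

variable {S : Subst L} {P : List ℕ} {k : ℕ} {φ : SFm L (k + 1)} {s : Fin k → CTm L} {n : ℕ}

theorem FirstFail.mono {S' : Subst L} (hS : S.Le S') (h : FirstFail S P φ s n) :
    FirstFail S' P φ s n := by
  obtain ⟨P₁, P₂, rfl, h₁, h₂⟩ := h
  exact ⟨P₁, P₂, rfl, fun m hm => hS.sat (h₁ m hm), hS.sat h₂⟩

open Classical in
theorem FirstFail.find?_eq_some (h : FirstFail S P φ s n) :
    P.find? (fun m => S.Sat (.not (φ.inst (Fin.cons (.num m) s)))) = some n := by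
  obtain ⟨P₁, P₂, rfl, h₁, h₂⟩ := h
  rw [List.find?_eq_some_iff_append]
  exact ⟨decide_eq_true h₂, P₁, P₂, rfl, fun m hm => by simpa using (h₁ m hm).not_sat_not⟩

theorem FirstFail.unique {n' : ℕ} (h : FirstFail S P φ s n) (h' : FirstFail S P φ s n') :
    n = n' :=
  Option.some_inj.1 (h.find?_eq_some.symm.trans h'.find?_eq_some)

end FirstFail

variable {S S' : Subst L} {P : List ℕ} {cr : Crit L} {e : CExpr L} {v : Val}

theorem HPair.mono (hS : S.Le S') (h : HPair O S P cr e v) : HPair O S' P cr e v := by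
  cases h with
  | pred s n v hs hv => exact .pred s n v (hS.evalTm hs) hv
  | eps φ s t a v hs ht => exact .eps φ s t a v (fun i => hS.evalTm (hs i)) (hS.evalTm ht)
  | ind φ s t a n v hs ht hvn h h' least =>
    exact .ind φ s t a n v (fun i => hS.evalTm (hs i)) (hS.evalTm ht) hvn (hS.sat h) (hS.sat h')
      fun m hm => hS.sat (least m hm)
  | indDef t n ht => exact .indDef t n (hS.evalTm ht)
  | closureNeg φ s a n v hs hn hA hv =>
    exact .closureNeg φ s a n v (fun i => hS.evalTm (hs i)) (hn.mono hS) (hS.sat hA) (hS _ _ hv)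
  | closurePos φ s a v hs hn hA =>
    exact .closurePos φ s a v (fun i => hS.evalTm (hs i)) (hn.mono hS) (hS.sat hA)

theorem eval_unique {k : ℕ} {s : Fin k → CTm L} {a a' : Fin k → ℕ}
    (h : ∀ i, (s i).eval S = some (a i)) (h' : ∀ i, (s i).eval S = some (a' i)) : a = a' :=
  funext fun i => Option.some_inj.1 ((h i).symm.trans (h' i))

theorem eq_of_least {φ : ℕ → CFm L} {m m' : ℕ} (h : S.Sat (φ m))
    (least : ∀ k < m, S.Sat (.not (φ k))) (h' : S.Sat (φ m'))
    (least' : ∀ k < m', S.Sat (.not (φ k))) : m = m' :=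
  le_antisymm (not_lt.1 fun hlt => h'.not_sat_not (least _ hlt))
    (not_lt.1 fun hlt => h.not_sat_not (least' _ hlt))

theorem HPair.unique {e' : CExpr L} {v' : Val} (h : HPair O S P cr e v)
    (h' : HPair O S P cr e' v') : e = e' ∧ v = v' := by
  cases h with
  | pred s n v hs hv =>
    cases h' with
    | pred _ n' v' hs' hv' =>
      obtain rfl : n = n' := Option.some_inj.1 (hs.symm.trans hs')
      exact ⟨rfl, congrArg Val.num (PNat.coe_injective (hv.trans hv'.symm))⟩
  | eps φ s t a v hs ht =>
    cases h' with
    | eps _ _ _ a' v' hs' ht' =>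
      obtain rfl := eval_unique hs hs'
      exact ⟨rfl, congrArg Val.num (PNat.coe_injective (Option.some_inj.1 (ht.symm.trans ht')))⟩
  | ind φ s t a n v hs ht hvn h h₁ least =>
    cases h' with
    | ind _ _ _ a' n' v' hs' ht' hvn' h' h₁' least' =>
      obtain rfl := eval_unique hs hs'
      obtain rfl : v = v' := PNat.coe_injective <| eq_of_least
        (Subst.sat_and_iff.2 ⟨h, h₁⟩) least (Subst.sat_and_iff.2 ⟨h', h₁'⟩) least'
      exact ⟨rfl, rfl⟩
  | indDef t n ht =>
    cases h' with
    | indDef _ n' ht' =>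
      obtain rfl : n = n' := Option.some_inj.1 (ht.symm.trans ht')
      exact ⟨rfl, rfl⟩
  | closureNeg φ s a n v hs hn hA hv =>
    cases h' with
    | closureNeg _ _ a' n' v' hs' hn' hA' hv' =>
      obtain rfl := eval_unique hs hs'
      obtain rfl := hn.unique hn'
      exact ⟨rfl, Option.some_inj.1 (hv.symm.trans hv')⟩
    | closurePos _ _ a' v' hs' hn' hA' =>
      obtain rfl := hn.unique hn'
      exact absurd hA hA'.not_sat_not
  | closurePos φ s a v hs hn hA =>
    cases h' with
    | closureNeg _ _ a' n' v' hs' hn' hA' hv' =>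
      obtain rfl := hn.unique hn'
      exact absurd hA' hA.not_sat_not
    | closurePos _ _ a' v' hs' hn' hA' =>
      obtain rfl := eval_unique hs hs'
      exact ⟨rfl, congrArg Val.num (PNat.coe_injective (hn.unique hn'))⟩

theorem HPair.exists_eq_num (h : HPair O S P cr e v) (he : e.rk O ≠ Ω) :
    ∃ u, v = .num u := by
  cases h with
  | indDef => exact absurd rfl he
  | _ => exact ⟨_, rfl⟩

theorem HApplies.mono {N : ℕ} {Cr : Fin (N + 1) → Crit L} (h : HApplies O Cr S P e v)
    (hS : S.Le S') (hc : S'.Correct O) (hcomp : S'.Computing O)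
    (hΩ : ∀ e, e.rk O = Ω → S' e = S e) : HApplies O Cr S' P e v where
  correct := hc
  nonsolving := fun hs => h.nonsolving fun i =>
    S.le_ext.sat (((h.decides i).sat_iff_of_le (hS.trans S'.le_ext)).1 (hs i))
  computing := hcomp
  decides := fun i => hS.decides (h.decides i)
  pairs := fun i hi => by
    obtain ⟨e', v', h'⟩ := h.pairs i (((h.decides i).sat_not_iff_of_le hS).1 hi)
    exact ⟨e', v', h'.mono hS⟩
  main := by
    obtain ⟨i, hi, hp, hmin⟩ := h.main
    refine ⟨i, hS.sat hi, hp.mono hS, fun j e' v' hj hp' => ?_⟩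
    have hj' := ((h.decides j).sat_not_iff_of_le hS).1 hj
    obtain ⟨e'', v'', hp''⟩ := h.pairs j hj'
    obtain ⟨rfl, rfl⟩ := hp'.unique (hp''.mono hS)
    exact hmin j _ _ hj' hp''
  unk := hS _ _ h.unk
  term := fun n hn => by
    rw [hΩ _ rfl]
    exact h.term n hn
  form := fun n hn => by
    rw [hΩ _ (rk_c O n)]
    exact h.form n hn
  conflict := fun n m hn hm => by
    rw [hΩ _ rfl]
    rw [hΩ _ (rk_c O m)] at hm
    exact h.conflict n m hn hm

end Pairs

section Sequents

theorem Subst.filter_congr {S S' : Subst L} {p : CExpr L → Val → Prop} {e : CExpr L}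
    (h : S e = S' e ∨ ∀ u, ¬ p e u) : S.filter p e = S'.filter p e := by
  unfold Subst.filter
  rcases h with h | h
  · rw [h]
  · cases S e <;> cases S' e <;> simp [h]

open Classical in
theorem Subst.filter_rk (S : Subst L) (p : Rank → Prop) (e : CExpr L) :
    S.filter (fun e' _ => p (e'.rk O)) e = if p (e.rk O) then S e else none := by
  unfold Subst.filter
  cases S e <;> simp

theorem Subst.filter_eq_none {S : Subst L} {p : CExpr L → Val → Prop} {e : CExpr L}
    (h : ∀ u, ¬ p e u) : S.filter p e = none := by
  unfold Subst.filter
  cases S e <;> simp [h]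

theorem Subst.negΩ_eq_none (S : Subst L) {e : CExpr L} (h : e.rk O ≠ Ω) : S.negΩ O e = none :=
  Subst.filter_eq_none fun _ hu => h hu.1

theorem Subst.posΩ_eq_none (S : Subst L) {e : CExpr L} (h : e.rk O ≠ Ω) : S.posΩ O e = none :=
  Subst.filter_eq_none fun _ hu => h hu.1

/-- The conditions on a sequent that are relevant at ranks other than `Ω`. In contrast to
`Sequent.IsSequent`, nothing relates `P` to `S`, so that they are easily seen to be preserved by
all rules and by `Sequent.splice`. -/
structure Sequent.Regular (O : OpForm L) (Ψ : Sequent L) : Prop where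
  record : ∀ m T e, Ψ.V m = some T → e.rk O ≠ Ω → T e = none
  ne_top : ∀ e, e.rk O ≠ Ω → Ψ.S e ≠ some .top
  domF : ∀ e, (Ψ.F e).isSome ↔ ∃ u, Ψ.S e = some u ∧ (u = .unk ∨ e.rk O = Ω)

variable {Ψ X : Sequent L} {e e' : CExpr L} {v : Val}

theorem Sequent.Regular.F_eq_none (h : Ψ.Regular O) (he : e.rk O ≠ Ω) (hu : Ψ.S e ≠ some .unk) :
    Ψ.F e = none := by
  rw [← Option.not_isSome_iff_eq_none, h.domF]
  rintro ⟨u, hu', rfl | hr⟩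
  exacts [hu hu', he hr]

theorem Sequent.Regular.unk_of_F (h : Ψ.Regular O) (he : e.rk O ≠ Ω) {i : Bool}
    (hi : Ψ.F e = some i) : Ψ.S e = some .unk := by
  by_contra hu
  simp [h.F_eq_none he hu] at hi

section HStep

theorem hData_of_rk_ne_Ω (he : e.rk O ≠ Ω) : (hData O e v Ψ).1 =
    (Ψ.S.filter fun e' _ => e'.rk O ≤ e.rk O).set e v := by
  unfold hData
  rcases he.lt_or_gt with h | h
  · rw [if_neg h.not_gt, if_pos h]
  · rw [if_pos h]

theorem hData_S_self : (hData O e v Ψ).1 e = some v := by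
  by_cases he : e.rk O = Ω
  · unfold hData
    rw [if_neg he.not_gt, if_neg he.not_lt]
    cases e <;> exact Subst.set_self ..
  · rw [hData_of_rk_ne_Ω he, Subst.set_self]

theorem hData_S_of_rk_eq_Ω (hΨ : Ψ.Regular O) (he : e.rk O = Ω) (he' : e'.rk O ≠ Ω) :
    (hData O e v Ψ).1 e' = Ψ.S.filter (fun e _ => e.rk O < Ω) e' := by
  have hne : e' ≠ e := ne_of_apply_ne (CExpr.rk O) (he ▸ he')
  unfold hData
  rw [if_neg he.not_gt, if_neg he.not_lt]
  cases e with
  | form m =>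
    simp only [Subst.set_of_ne hne, Subst.union, Ψ.S.posΩ_eq_none he', Option.or_none]
  | term c =>
    have filter_history (p : ℕ → Prop) : (Ψ.S.filter fun e' u => ∃ m, p m ∧
        (e' = O.c m ∧ u = .unk ∨ e' = .form m ∧ u = .top)) e' = none := by
      refine Subst.filter_eq_none fun u => ?_
      rintro ⟨m, -, ⟨rfl, -⟩ | ⟨rfl, -⟩⟩
      exacts [he' (rk_c O m), he' rfl]
    have record (m : ℕ) : (Ψ.V m).getD (fun _ => none) e' = none := by
      cases hT : Ψ.V m with
      | none => rfl
      | some T => exact hΨ.record m T e' hT he'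
    simp only [Subst.set_of_ne hne, Subst.union, filter_history, Option.none_or]
    split_ifs <;> simp only [record, Ψ.S.negΩ_eq_none he', Option.or_none]

theorem hData_S_of_ne (hΨ : Ψ.Regular O) (hne : e' ≠ e) (hΩ : e.rk O = Ω → e'.rk O ≠ Ω) :
    (hData O e v Ψ).1 e' = if e'.rk O ≤ e.rk O then Ψ.S e' else none := by
  by_cases he : e.rk O = Ω
  · rw [hData_S_of_rk_eq_Ω hΨ he (hΩ he), Subst.filter_rk Ψ.S (· < Ω), he]
    simp only [(hΩ he).le_iff_lt]
    split_ifs <;> rfl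
  · rw [hData_of_rk_ne_Ω he, Subst.set_of_ne hne, Subst.filter_rk Ψ.S (· ≤ e.rk O)]
    split_ifs <;> rfl

theorem hSeq_F_of_ne (hΨ : Ψ.Regular O) (hne : e' ≠ e) (hΩ : e.rk O = Ω → e'.rk O ≠ Ω) :
    (hSeq O e v Ψ).F e' = if e'.rk O ≤ e.rk O then Ψ.F e' else none := by
  have hF := hΨ.domF e'
  simp only [hSeq, hData_S_of_ne hΨ hne hΩ]
  split_ifs with hle
  · cases hS : Ψ.S e' <;> cases hi : Ψ.F e' <;> simp_all
  · rfl

theorem hData_S_low {n : ℕ} (hΨ : Ψ.Regular O) (he : Sum.inlₗ n < e.rk O)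
    (he' : e'.rk O ≤ Sum.inlₗ n) : (hData O e v Ψ).1 e' = Ψ.S e' := by
  have hne : e' ≠ e := ne_of_apply_ne (CExpr.rk O) (he'.trans_lt he).ne
  rw [hData_S_of_ne hΨ hne fun _ => (he'.trans_lt (inl_lt_Ω n)).ne, if_pos (he'.trans he.le)]

theorem hSeq_F_low {n : ℕ} (hΨ : Ψ.Regular O) (he : Sum.inlₗ n < e.rk O)
    (he' : e'.rk O ≤ Sum.inlₗ n) : (hSeq O e v Ψ).F e' = Ψ.F e' := by
  have hne : e' ≠ e := ne_of_apply_ne (CExpr.rk O) (he'.trans_lt he).ne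
  rw [hSeq_F_of_ne hΨ hne fun _ => (he'.trans_lt (inl_lt_Ω n)).ne, if_pos (he'.trans he.le)]

theorem Active.eq (h : Active O e v Ψ e') (hΨ : Ψ.Regular O) (he : e.rk O ≠ Ω) : e' = e := by
  by_contra hne
  refine h.2.2 ((hData_S_of_ne hΨ hne fun h => absurd h he).trans (if_pos h.2.1.le))

theorem active_self (h : Ψ.S e = some .unk) (hv : v ≠ .unk) : Active O e v Ψ e := by
  refine ⟨Option.isSome_of_eq_some h, rfl, fun heq => hv ?_⟩
  rw [h] at heq
  exact Option.some_inj.1 (hData_S_self.symm.trans heq)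

end HStep

open Classical in
/-- The sequent obtained from `X` by revising the value of `e` to the positive numeral `u`. -/
noncomputable def Sequent.revise (e : CExpr L) (u : ℕ+) (X : Sequent L) : Sequent L :=
  { X with S := X.S.set e (.num u), F := Function.update X.F e none }

namespace Sequent

theorem Regular.empty : (Sequent.empty : Sequent L).Regular O := by
  constructor <;> simp [Sequent.empty]

theorem Regular.addUnk (h : X.Regular O) (e : CExpr L) (i : Bool) : (X.addUnk e i).Regular O where
  record := h.record
  ne_top := fun e' he' => by
    by_cases hne : e' = e
    · simp [hne, Sequent.addUnk, Subst.set_self]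
    · simpa [Sequent.addUnk, Subst.set_of_ne hne] using h.ne_top e' he'
  domF := fun e' => by
    by_cases hne : e' = e
    · simp [hne, Sequent.addUnk, Subst.set_self]
    · simpa [Sequent.addUnk, Subst.set_of_ne hne, hne] using h.domF e'

theorem Regular.revise (h : X.Regular O) (he : e.rk O ≠ Ω) (u : ℕ+) :
    (X.revise e u).Regular O where
  record := h.record
  ne_top := fun e' he' => by
    by_cases hne : e' = e
    · simp [hne, Sequent.revise, Subst.set_self]
    · simpa [Sequent.revise, Subst.set_of_ne hne] using h.ne_top e' he'
  domF := fun e' => by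
    by_cases hne : e' = e
    · simp [hne, Sequent.revise, Subst.set_self, he]
    · simpa [Sequent.revise, Subst.set_of_ne hne, hne] using h.domF e'

theorem addVal_eq_revise (h : X.Regular O) (he : e.rk O ≠ Ω) (hn : X.S e = none) (u : ℕ+) :
    X.addVal e u = X.revise e u := by
  have hF : X.F e = none := h.F_eq_none he (by simp [hn])
  simp [addVal, revise, ← hF]

theorem Regular.addVal (h : X.Regular O) (he : e.rk O ≠ Ω) (hn : X.S e = none) (u : ℕ+) :
    (X.addVal e u).Regular O :=
  addVal_eq_revise h he hn u ▸ h.revise he u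

theorem Regular.hSeq (h : Ψ.Regular O) (hv : e.rk O ≠ Ω → v ≠ .top) :
    (hSeq O e v Ψ).Regular O where
  record := fun m T e' hT he' => by
    by_cases he : e.rk O = Ω
    · simp only [EpsID.hSeq, hData, he, lt_irrefl, if_false] at hT
      cases e with
      | form k =>
        by_cases hk : m = k
        · simp only [hk, Function.update_self, Option.some_inj] at hT
          exact hT ▸ Ψ.S.negΩ_eq_none he'
        · simp only [Function.update_of_ne hk] at hT
          exact h.record m T e' hT he'
      | term c =>
        simp only at hT
        split_ifs at hT
        all_goals exact h.record m T e' hT he'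
    · unfold EpsID.hSeq hData at hT
      split_ifs at hT with h₁ h₂
      · exact h.record m T e' hT he'
      · exact absurd (eq_of_le_of_not_lt (not_lt.1 h₁) h₂) he
  ne_top := fun e' he' htop => by
    by_cases hne : e' = e
    · subst hne
      exact hv he' (Option.some_inj.1 (hData_S_self.symm.trans htop))
    · have hS := (hData_S_of_ne (v := v) h hne fun _ => he').symm.trans htop
      split_ifs at hS
      exact h.ne_top e' he' hS
  domF := fun e' => by
    simp only [EpsID.hSeq]
    cases (hData O e v Ψ).1 e' <;> simp

end Sequent

end Sequents

section Splice

open Classical in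
/-- The sequent that agrees with `X` on the expressions of rank at most `n`, and with `Ψ`
otherwise; its history is the one of `Ψ`. -/
noncomputable def Sequent.splice (O : OpForm L) (n : ℕ) (Ψ X : Sequent L) : Sequent L where
  S := fun e => if e.rk O ≤ Sum.inlₗ n then X.S e else Ψ.S e
  P := Ψ.P
  V := Ψ.V
  F := fun e => if e.rk O ≤ Sum.inlₗ n then X.F e else Ψ.F e

variable {n : ℕ} {Ψ X : Sequent L} {e e' : CExpr L} {v : Val}

theorem splice_S_low (h : e.rk O ≤ Sum.inlₗ n) : (Ψ.splice O n X).S e = X.S e := if_pos h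

theorem splice_S_high (h : Sum.inlₗ n < e.rk O) : (Ψ.splice O n X).S e = Ψ.S e := if_neg h.not_ge

theorem splice_F_low (h : e.rk O ≤ Sum.inlₗ n) : (Ψ.splice O n X).F e = X.F e := if_pos h

theorem splice_F_high (h : Sum.inlₗ n < e.rk O) : (Ψ.splice O n X).F e = Ψ.F e := if_neg h.not_ge

theorem splice_S_Ω (h : e.rk O = Ω) : (Ψ.splice O n X).S e = Ψ.S e :=
  splice_S_high (h ▸ inl_lt_Ω n)

theorem splice_negΩ : (Ψ.splice O n X).S.negΩ O = Ψ.S.negΩ O := funext fun e =>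
  Subst.filter_congr <| (em (e.rk O = Ω)).imp splice_S_Ω fun h _ hu => h hu.1

theorem leOn_splice (h : Ψ.S.LeOn {e | e.rk O ≤ Sum.inlₗ n} X.S) :
    Ψ.S.Le (Ψ.splice O n X).S := fun e u hu => by
  by_cases he : e.rk O ≤ Sum.inlₗ n
  · rw [splice_S_low he]
    exact h e he u hu
  · rwa [splice_S_high (not_le.1 he)]

theorem Sequent.Regular.splice (hΨ : Ψ.Regular O) (hX : X.Regular O) (n : ℕ) :
    (Ψ.splice O n X).Regular O where
  record := hΨ.record
  ne_top := fun e he => by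
    simp only [Sequent.splice]
    split_ifs
    exacts [hX.ne_top e he, hΨ.ne_top e he]
  domF := fun e => by
    simp only [Sequent.splice]
    split_ifs
    exacts [hX.domF e, hΨ.domF e]

theorem splice_addUnk_low (he : e.rk O ≤ Sum.inlₗ n) (i : Bool) :
    (Ψ.addUnk e i).splice O n X = Ψ.splice O n X := by
  ext1 <;> try rfl
  all_goals
    funext e'
    simp only [Sequent.splice, Sequent.addUnk, Subst.set, Function.update_apply]
    grind

theorem splice_addUnk_high (he : Sum.inlₗ n < e.rk O) (i : Bool) :
    (Ψ.addUnk e i).splice O n X = (Ψ.splice O n X).addUnk e i := by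
  ext1 <;> try rfl
  all_goals
    funext e'
    simp only [Sequent.splice, Sequent.addUnk, Subst.set, Function.update_apply]
    grind [he.not_ge]

theorem splice_addVal_low (he : e.rk O ≤ Sum.inlₗ n) (u : ℕ+) :
    (Ψ.addVal e u).splice O n X = Ψ.splice O n X := by
  ext1 <;> try rfl
  funext e'
  simp only [Sequent.splice, Sequent.addVal, Subst.set, Function.update_apply]
  grind

theorem splice_addUnk_right (he : e.rk O ≤ Sum.inlₗ n) (i : Bool) :
    Ψ.splice O n (X.addUnk e i) = (Ψ.splice O n X).addUnk e i := by
  ext1 <;> try rfl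
  all_goals
    funext e'
    simp only [Sequent.splice, Sequent.addUnk, Subst.set, Function.update_apply]
    grind

theorem splice_revise_right (he : e.rk O ≤ Sum.inlₗ n) (u : ℕ+) :
    Ψ.splice O n (X.revise e u) = (Ψ.splice O n X).revise e u := by
  ext1 <;> try rfl
  all_goals
    funext e'
    simp only [Sequent.splice, Sequent.revise, Subst.set, Function.update_apply]
    grind

theorem splice_addVal_right (he : e.rk O ≤ Sum.inlₗ n) (u : ℕ+) :
    Ψ.splice O n (X.addVal e u) = (Ψ.splice O n X).addVal e u := by
  ext1 <;> try rfl
  funext e'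
  simp only [Sequent.splice, Sequent.addVal, Subst.set, Function.update_apply]
  grind

theorem hData_splice_S_high (he' : Sum.inlₗ n < e'.rk O) :
    (hData O e v (Ψ.splice O n X)).1 e' = (hData O e v Ψ).1 e' := by
  by_cases hne : e' = e
  · rw [hne, hData_S_self, hData_S_self]
  · have hf (p) : (Ψ.splice O n X).S.filter p e' = Ψ.S.filter p e' :=
      Subst.filter_congr (Or.inl (splice_S_high he'))
    unfold hData
    split_ifs
    · simp only [Subst.set_of_ne hne, hf]
    · simp only [Subst.set_of_ne hne, hf]
    · cases e with
      | form m => simp only [Subst.set_of_ne hne, Subst.union, Subst.posΩ, hf]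
      | term c =>
        simp only [Subst.set_of_ne hne, Subst.union, splice_negΩ, hf]
        rfl

theorem hData_splice_history : (hData O e v (Ψ.splice O n X)).2 = (hData O e v Ψ).2 := by
  unfold hData
  split_ifs
  · rfl
  · rfl
  · cases e with
    | form m => simp only [splice_negΩ]; rfl
    | term c => rfl

theorem hSeq_splice (hΨ : Ψ.Regular O) (hX : X.Regular O) (he : Sum.inlₗ n < e.rk O) :
    hSeq O e v (Ψ.splice O n X) = (hSeq O e v Ψ).splice O n X := by
  have hreg := hΨ.splice hX n
  refine Sequent.ext (funext fun e' => ?_) (congrArg Prod.fst hData_splice_history)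
    (congrArg Prod.snd hData_splice_history) (funext fun e' => ?_) <;>
  rcases le_or_gt (e'.rk O) (Sum.inlₗ n) with h | h
  · exact (hData_S_low hreg he h).trans ((splice_S_low h).trans (splice_S_low h).symm)
  · exact (hData_splice_S_high h).trans (splice_S_high (Ψ := hSeq O e v Ψ) h).symm
  · rw [hSeq_F_low hreg he h, splice_F_low h, splice_F_low h]
  · rw [splice_F_high h]
    simp only [hSeq, hData_splice_S_high h, splice_F_high h]

theorem active_splice (hΨ : Ψ.Regular O) (hX : X.Regular O) (he : Sum.inlₗ n < e.rk O) :
    Active O e v (Ψ.splice O n X) e' ↔ Active O e v Ψ e' := by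
  unfold Active
  rw [hSeq_splice hΨ hX he]
  by_cases h : e'.rk O = e.rk O
  · have h' : Sum.inlₗ n < e'.rk O := h ▸ he
    simp only [Subst.dom, Set.mem_ofPred_eq, splice_S_high h']
  · simp [h]

end Splice

section Low

/-- `X` is a regular sequent with empty history that consists of expressions of rank at most `n`,
of which only those of rank `n` may be temporary. -/
structure Low (O : OpForm L) (n : ℕ) (X : Sequent L) : Prop where
  regular : X.Regular O
  low : Sequent.empty.splice O n X = X
  temp : ∀ e, X.F e = some true → e.rk O = Sum.inlₗ n

variable {n : ℕ} {Ψ X : Sequent L} {e : CExpr L}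

theorem Low.rk_le (h : Low O n X) {u : Val} (hu : X.S e = some u) : e.rk O ≤ Sum.inlₗ n := by
  by_contra he
  rw [← h.low, splice_S_high (not_le.1 he)] at hu
  exact nomatch hu

theorem Low.rk_ne_Ω (h : Low O n X) {u : Val} (hu : X.S e = some u) : e.rk O ≠ Ω :=
  ((h.rk_le hu).trans_lt (inl_lt_Ω n)).ne

theorem Low.le_splice (h : Low O n X) (Ψ : Sequent L) : X.S.Le (Ψ.splice O n X).S :=
  fun _ _ hu => (splice_S_low (h.rk_le hu)).trans hu

theorem Low.addUnk (h : Low O n X) (he : e.rk O ≤ Sum.inlₗ n) {i : Bool}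
    (hi : i = true → e.rk O = Sum.inlₗ n) : Low O n (X.addUnk e i) where
  regular := h.regular.addUnk e i
  low := by rw [splice_addUnk_right he, h.low]
  temp := fun e' => by
    by_cases hne : e' = e
    · simpa [hne, Sequent.addUnk] using hi
    · simpa [Sequent.addUnk, hne] using h.temp e'

theorem Low.revise (h : Low O n X) (he : e.rk O ≤ Sum.inlₗ n) (u : ℕ+) :
    Low O n (X.revise e u) where
  regular := h.regular.revise (he.trans_lt (inl_lt_Ω n)).ne u
  low := by rw [splice_revise_right he, h.low]
  temp := fun e' => by
    by_cases hne : e' = e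
    · simp [hne, Sequent.revise]
    · simpa [Sequent.revise, hne] using h.temp e'

theorem Low.addVal (h : Low O n X) (he : e.rk O ≤ Sum.inlₗ n) (hn : X.S e = none) (u : ℕ+) :
    Low O n (X.addVal e u) :=
  Sequent.addVal_eq_revise h.regular (he.trans_lt (inl_lt_Ω n)).ne hn u ▸ h.revise he u

theorem Sequent.splice_splice_empty (O : OpForm L) (n : ℕ) (Ψ Ψ' : Sequent L) :
    Ψ'.splice O n (Sequent.empty.splice O n Ψ) = Ψ'.splice O n Ψ := by
  ext1 <;> try rfl
  all_goals
    funext e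
    simp only [Sequent.splice]
    grind

theorem Sequent.splice_self (O : OpForm L) (n : ℕ) (Ψ : Sequent L) : Ψ.splice O n Ψ = Ψ := by
  unfold Sequent.splice
  congr <;> funext e <;> split_ifs <;> rfl

theorem Sequent.Regular.low_splice_empty (h : Ψ.Regular O)
    (hF : ∀ e, e.rk O ≤ Sum.inlₗ n → Ψ.F e ≠ some true) :
    Low O n (Sequent.empty.splice O n Ψ) where
  regular := Sequent.Regular.empty.splice h n
  low := Sequent.splice_splice_empty O n Ψ _
  temp := fun e he => by
    by_cases hle : e.rk O ≤ Sum.inlₗ n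
    · exact absurd ((splice_F_low hle).symm.trans he) (hF e hle)
    · rw [splice_F_high (not_le.1 hle)] at he
      exact nomatch he

theorem Low.hSeq_splice (hX : Low O n X) (hΨ : Ψ.Regular O) (he : e.rk O = Sum.inlₗ n) (w : ℕ+) :
    hSeq O e (.num w) (Ψ.splice O n X) = X.revise e w := by
  have hne : e.rk O ≠ Ω := he ▸ (inl_lt_Ω n).ne
  have hreg := hΨ.splice hX.regular n
  have history : (hData O e (.num w) (Ψ.splice O n X)).2 = ([], fun _ => none) := by
    unfold hData
    rw [if_neg (he ▸ (inl_lt_Ω n).not_gt), if_pos (he ▸ inl_lt_Ω n)]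
  refine Sequent.ext (funext fun e' => ?_) ?_ ?_ (funext fun e' => ?_)
  · by_cases h : e' = e
    · rw [h]
      exact hData_S_self.trans (Subst.set_self ..).symm
    · refine (hData_S_of_ne hreg h (absurd · hne)).trans (Eq.trans ?_ (Subst.set_of_ne h _ _).symm)
      conv_rhs => rw [← hX.low]
      simp only [he, Sequent.splice, Sequent.empty]
      split_ifs <;> rfl
  · exact (congrArg Prod.fst history).trans (congrArg Sequent.P hX.low)
  · exact (congrArg Prod.snd history).trans (congrArg Sequent.V hX.low)
  · by_cases h : e' = e
    · simp [h, Sequent.revise, hSeq, hData_S_self, hne]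
    · have update : (X.revise e w).F e' = X.F e' := by
        classical exact Function.update_of_ne h ..
      rw [hSeq_F_of_ne hreg h (absurd · hne), he, update]
      conv_rhs => rw [← hX.low]
      simp only [Sequent.splice, Sequent.empty]
      split_ifs <;> rfl

end Low

section Derivability

/-- A condition on the kind and the rank of a rule: `Cut` rules have ranks that satisfy `cut`, `Fr`
and `H` rules have ranks that satisfy `other`, and there are no `CutFr` rules. -/
def RuleBound (cut other : Rank → Prop) : Kind → Rank → Prop
  | .cut, q => cut q
  | .cutFr, _ => False
  | .fr, q => other q
  | .h, q => other q

theorem RuleBound.mono {cut cut' other other' : Rank → Prop} (h : ∀ q, cut q → cut' q)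
    (h' : ∀ q, other q → other' q) {X : Kind} {q : Rank} (hX : RuleBound cut other X q) :
    RuleBound cut' other' X q := by
  cases X with
  | cut => exact h q hX
  | cutFr => exact hX
  | fr => exact h' q hX
  | h => exact h' q hX

variable [L.Structure ℕ] {N : ℕ} {Cr : Fin (N + 1) → Crit L}

variable (O Cr) in
/-- There is an `r`-derivation of a sequent. This propositional counterpart of
`Deduction.IsRDeduction` allows for inductions on `r`-derivations. -/
inductive RDerivable (r : Rank) : Sequent L → Prop
  | ax {Θ : Sequent L} (h : IsAxiom O Cr Θ) : RDerivable r Θ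
  | inf {X : Kind} {e : CExpr L} {Θ : Sequent L} {Pr : Set (Sequent L)}
      (h : Inference O Cr X e Θ Pr) (hX : RuleBound (· < r) (r ≤ ·) X (e.rk O))
      (d : ∀ Θ' ∈ Pr, RDerivable r Θ') : RDerivable r Θ

theorem Deduction.IsRDeduction.rDerivable {r : Rank} {Θ : Sequent L} {d : Derivation O Cr Θ}
    (h : d.IsRDeduction r) : RDerivable O Cr r Θ := by
  induction d with
  | hyp Θ hΘ => exact hΘ.elim
  | ax Θ hΘ => exact .ax hΘ
  | inf X e Θ Pr hi d ih =>
    refine .inf hi ?_ fun Θ' hΘ' => ih Θ' hΘ'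
      ⟨h.cut.2 _ hΘ', h.cutFr.2 _ hΘ', h.fr.2 _ hΘ', h.h.2 _ hΘ'⟩
    cases X with
    | cut => exact h.cut.1 rfl
    | cutFr => exact not_lt_inl_zero _ (h.cutFr.1 rfl)
    | fr => exact h.fr.1 rfl
    | h => exact h.h.1 rfl

theorem RDerivable.exists_derivation {r : Rank} {Θ : Sequent L} (h : RDerivable O Cr r Θ) :
    ∃ d : Derivation O Cr Θ, d.IsRDeduction r := by
  induction h with
  | ax h => exact ⟨.ax _ h, trivial, trivial, trivial, trivial⟩
  | @inf X e Θ Pr hi hX _ ih =>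
    choose d hd using ih
    refine ⟨.inf X e Θ Pr hi d, ⟨?_, fun Θ' h => (hd Θ' h).cut⟩, ⟨?_, fun Θ' h => (hd Θ' h).cutFr⟩,
      ⟨?_, fun Θ' h => (hd Θ' h).fr⟩, ⟨?_, fun Θ' h => (hd Θ' h).h⟩⟩ <;> rintro rfl
    · exact hX
    · exact hX.elim
    · exact hX
    · exact hX

theorem Inference.pathStep {r : Rank} {X : Kind} {e : CExpr L} {Θ Θ' : Sequent L}
    {Pr : Set (Sequent L)} (h : Inference O Cr X e Θ Pr)
    (hX : RuleBound (· ≤ r) (Ω ≤ ·) X (e.rk O)) (hΘ' : Θ' ∈ Pr) : PathStep O Cr r Θ Θ' :=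
  ⟨X, e, Pr, h, hΘ', by cases X <;> exact hX⟩

theorem PathStep.exists_inference {r : Rank} {Θ Θ' : Sequent L} (h : PathStep O Cr r Θ Θ') :
    ∃ X e Pr, Inference O Cr X e Θ Pr ∧ Θ' ∈ Pr ∧ RuleBound (· ≤ r) (Ω ≤ ·) X (e.rk O) := by
  obtain ⟨X, e, Pr, hi, hΘ', hX⟩ := h
  exact ⟨X, e, Pr, hi, hΘ', by cases X <;> exact hX⟩

theorem PathStep.mono {r r' : Rank} (hr : r ≤ r') {Θ Θ' : Sequent L}
    (h : PathStep O Cr r Θ Θ') : PathStep O Cr r' Θ Θ' := by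
  obtain ⟨X, e, Pr, hi, hΘ', hX⟩ := h.exists_inference
  exact hi.pathStep (hX.mono (fun _ hq => hq.trans hr) fun _ => id) hΘ'

theorem HasPath.reflTransGen {r : Rank} {Θ : Sequent L} (h : HasPath O Cr r Θ) :
    Relation.ReflTransGen (PathStep O Cr r) Sequent.empty Θ := by
  obtain ⟨n, Θs, h0, rfl, hs⟩ := h
  induction n with
  | zero => rw [h0]
  | succ n ih => exact (ih fun i hi => hs i (hi.trans n.lt_succ_self)).tail (hs n n.lt_succ_self)

end Derivability

section Fits

variable [L.Structure ℕ] {n : ℕ} {Ψ X : Sequent L}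

/-- `X` extends the part of `Ψ` of rank at most `n`, and it satisfies the formulas that justify the
values of the additional expressions. -/
structure Fits (O : OpForm L) (n : ℕ) (Ψ X : Sequent L) : Prop where
  le : Ψ.S.LeOn {e | e.rk O ≤ Sum.inlₗ n} X.S
  just : ∀ e u, X.S e = some u → e ∈ Ψ.S.dom ∨ X.S.Sat (FFm O e u)

theorem Fits.sat_splice {c : CanTerm L} {u : Val} (h : Fits O n Ψ X) (hX : Low O n X)
    (hc : Ψ.S.Correct O) (hc' : Ψ.S.Computing O) (hu : (Ψ.splice O n X).S (.term c) = some u) :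
    (Ψ.splice O n X).S.Sat (FFm O (.term c) u) := by
  by_cases he : (CExpr.term c).rk O ≤ Sum.inlₗ n
  · rw [splice_S_low he] at hu
    refine (h.just _ _ hu).elim (fun hd => ?_) (hX.le_splice Ψ).sat
    obtain ⟨u', hu'⟩ := Option.isSome_iff_exists.1 hd
    obtain rfl : u = u' := Option.some_inj.1 (hu.symm.trans (h.le _ he _ hu'))
    exact (leOn_splice h.le).sat (Subst.sat_FFm hc hc' hu')
  · rw [splice_S_high (not_le.1 he)] at hu
    exact (leOn_splice h.le).sat (Subst.sat_FFm hc hc' hu)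

theorem Fits.correct (h : Fits O n Ψ X) (hX : Low O n X) (hc : Ψ.S.Correct O)
    (hc' : Ψ.S.Computing O) : (Ψ.splice O n X).S.Correct O := by
  intro e u hu
  cases e with
  | term c => exact (Subst.le_ext _).sat (h.sat_splice hX hc hc' hu)
  | form m =>
    cases u with
    | unk => exact Subst.sat_top _
    | num u => exact Subst.sat_top _
    | top =>
      rw [splice_S_Ω rfl] at hu
      refine CFm.eval_mono (fun e he u => ?_) (A_inst_over O m) (hc _ _ hu)
      rw [Subst.ext, Subst.ext, splice_S_Ω he]
      exact id

theorem Fits.hApplies {N : ℕ} {Cr : Fin (N + 1) → Crit L} {e : CExpr L} {v : Val}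
    (h : Fits O n Ψ X) (hX : Low O n X) (ha : HApplies O Cr Ψ.S Ψ.P e v) :
    HApplies O Cr (Ψ.splice O n X).S (Ψ.splice O n X).P e v :=
  ha.mono (leOn_splice h.le) (h.correct hX ha.correct ha.computing)
    (fun _ _ hu => Or.inl (h.sat_splice hX ha.correct ha.computing hu)) fun _ => splice_S_Ω

end Fits

section Paths

variable [L.Structure ℕ] {N : ℕ} {Cr : Fin (N + 1) → Crit L} {n : ℕ} {Ψ Ψ' X : Sequent L}

variable (O Cr) in
/-- `Ψ'` is a premise of an inference with conclusion `Ψ` by a `Cut` rule of rank at most `n` or an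
`Fr` or `H` rule of rank greater than `n`. Along such steps the part of rank at most `n` only grows,
by expressions that are fixed. -/
inductive HighStep (n : ℕ) : Sequent L → Sequent L → Prop
  | cutUnk {Ψ : Sequent L} {e : CExpr L} (hn : Ψ.S e = none) (he : e.rk O ≤ Sum.inlₗ n) :
      HighStep n Ψ (Ψ.addUnk e false)
  | cutVal {Ψ : Sequent L} {e : CExpr L} (hn : Ψ.S e = none) (he : e.rk O ≤ Sum.inlₗ n) (u : ℕ+) :
      HighStep n Ψ (Ψ.addVal e u)
  | fr {Ψ : Sequent L} {e : CExpr L} (hn : Ψ.S e = none) (he : Sum.inlₗ n < e.rk O) :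
      HighStep n Ψ (Ψ.addUnk e true)
  | h {Ψ : Sequent L} {e : CExpr L} {v : Val} (he : Sum.inlₗ n < e.rk O)
      (happ : HApplies O Cr Ψ.S Ψ.P e v) (temp : ∀ e', Active O e v Ψ e' → Ψ.F e' = some true) :
      HighStep n Ψ (hSeq O e v Ψ)

theorem Inference.highStep {K : Kind} {e : CExpr L} {Pr : Set (Sequent L)}
    (hi : Inference O Cr K e Ψ Pr) (hK : RuleBound (· ≤ Sum.inlₗ n) (Sum.inlₗ n < ·) K (e.rk O))
    (hΨ' : Ψ' ∈ Pr) : HighStep O Cr n Ψ Ψ' := by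
  cases hi with
  | cut c Θ hr hc =>
    have hn := Subst.notMem_dom.1 hc
    obtain rfl | ⟨u, rfl⟩ := hΨ'
    exacts [.cutUnk hn hK, .cutVal hn hK u]
  | cutFr => exact hK.elim
  | cutTerm c Θ hr => exact absurd (hr ▸ hK) (inl_lt_Ω n).not_ge
  | cutFrTerm => exact hK.elim
  | cutForm m => exact absurd hK (inl_lt_Ω n).not_ge
  | fr e Θ he =>
    obtain rfl := hΨ'
    exact .fr (Subst.notMem_dom.1 he) hK
  | h e v Θ happ temp =>
    obtain rfl := hΨ'
    exact .h hK happ temp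

theorem PathStep.highStep {m : ℕ} (hnm : n ≤ m)
    (h : PathStep O Cr (Sum.inlₗ n) Ψ Ψ') : HighStep O Cr m Ψ Ψ' := by
  obtain ⟨X, e, Pr, hi, hΨ', hX⟩ := h.exists_inference
  exact hi.highStep (hX.mono (fun q hq => le_trans hq (Sum.Lex.inl_le_inl_iff.2 hnm))
    fun q => (inl_lt_Ω m).trans_le) hΨ'

theorem HApplies.ne_top {S : Subst L} {P : List ℕ} {e : CExpr L} {v : Val}
    (h : HApplies O Cr S P e v) (he : e.rk O ≠ Ω) : v ≠ .top := by
  obtain ⟨i, -, hp, -⟩ := h.main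
  obtain ⟨u, rfl⟩ := hp.exists_eq_num he
  exact nofun

theorem HighStep.regular (h : HighStep O Cr n Ψ Ψ') (hΨ : Ψ.Regular O) : Ψ'.Regular O := by
  cases h with
  | cutUnk hn he => exact hΨ.addUnk _ _
  | cutVal hn he u => exact hΨ.addVal (he.trans_lt (inl_lt_Ω n)).ne hn u
  | fr hn he => exact hΨ.addUnk _ _
  | h he happ => exact hΨ.hSeq happ.ne_top

theorem HighStep.leOn (h : HighStep O Cr n Ψ Ψ') (hΨ : Ψ.Regular O) :
    Ψ.S.LeOn {e | e.rk O ≤ Sum.inlₗ n} Ψ'.S := by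
  cases h with
  | cutUnk hn => exact (Subst.le_set hn _).leOn _
  | cutVal hn => exact (Subst.le_set hn _).leOn _
  | fr hn => exact (Subst.le_set hn _).leOn _
  | @h e v he => exact fun e' he' u hu => (hData_S_low hΨ he he').trans hu

theorem HighStep.fixed (h : HighStep O Cr n Ψ Ψ') (hΨ : Ψ.Regular O)
    (hF : ∀ e, e.rk O ≤ Sum.inlₗ n → Ψ.F e ≠ some true) (e : CExpr L) (he : e.rk O ≤ Sum.inlₗ n) :
    Ψ'.F e ≠ some true := by
  cases h with
  | @cutUnk e' =>
    by_cases hne : e = e'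
    · simp [hne, Sequent.addUnk]
    · simpa [Sequent.addUnk, hne] using hF e he
  | cutVal => exact hF e he
  | @fr e' _ he' =>
    have hne : e ≠ e' := ne_of_apply_ne (CExpr.rk O) (he.trans_lt he').ne
    simpa [Sequent.addUnk, hne] using hF e he
  | h he' => exact hSeq_F_low hΨ he' he ▸ hF e he

theorem regular_of_path (h : Relation.ReflTransGen (HighStep O Cr n) Sequent.empty Ψ) :
    Ψ.Regular O := by
  induction h with
  | refl => exact .empty
  | tail _ hstep ih => exact hstep.regular ih

theorem fixed_of_path (h : Relation.ReflTransGen (HighStep O Cr n) Sequent.empty Ψ) :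
    ∀ e, e.rk O ≤ Sum.inlₗ n → Ψ.F e ≠ some true := by
  induction h with
  | refl => exact fun _ _ => nofun
  | tail hΨ hstep ih => exact hstep.fixed (regular_of_path hΨ) ih

theorem HighStep.rDerivable_splice (h : HighStep O Cr n Ψ Ψ') (hΨ : Ψ.Regular O) (hX : Low O n X)
    (hfit : Fits O n Ψ X) (hd : RDerivable O Cr (Sum.inlₗ n) (Ψ'.splice O n X)) :
    RDerivable O Cr (Sum.inlₗ n) (Ψ.splice O n X) := by
  cases h with
  | cutUnk hn he => rwa [splice_addUnk_low he] at hd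
  | cutVal hn he u => rwa [splice_addVal_low he] at hd
  | @fr e hn he =>
    rw [splice_addUnk_high he] at hd
    refine .inf (.fr e _ ?_) he.le fun Θ' hΘ' => hΘ' ▸ hd
    rwa [Subst.notMem_dom, splice_S_high he]
  | @h e v he happ temp =>
    rw [← hSeq_splice hΨ hX.regular he] at hd
    refine .inf (.h e v _ (hfit.hApplies hX happ) fun e' he' => ?_) he.le fun Θ' hΘ' => hΘ' ▸ hd
    have active := (active_splice hΨ hX.regular he).1 he'
    rw [splice_F_high (active.2.1 ▸ he)]
    exact temp e' active

/-- Replaying a path: its `Fr` and `H` rules are applied to `X`, whereas its `Cut` rules are omitted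
as `X` contains their main expressions. -/
theorem rDerivable_of_path (h : Relation.ReflTransGen (HighStep O Cr n) Sequent.empty Ψ)
    (hX : Low O n X) (hle : Ψ.S.LeOn {e | e.rk O ≤ Sum.inlₗ n} X.S)
    (hjust : ∀ e u, X.S e = some u → X.S.Sat (FFm O e u))
    (hd : RDerivable O Cr (Sum.inlₗ n) (Ψ.splice O n X)) : RDerivable O Cr (Sum.inlₗ n) X := by
  induction h with
  | refl => rwa [hX.low] at hd
  | tail hΨ hstep ih =>
    have hle' := fun e he u hu => hle e he u (hstep.leOn (regular_of_path hΨ) e he u hu)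
    exact ih hle' (hstep.rDerivable_splice (regular_of_path hΨ) hX
      ⟨hle', fun e u hu => Or.inr (hjust e u hu)⟩ hd)

end Paths

section Deciding

variable [L.Structure ℕ] {N : ℕ} {Cr : Fin (N + 1) → Crit L} {n : ℕ} {X X' X'' : Sequent L}
  {e : CExpr L}

/-- `X'` extends `X` by fixed expressions whose values are justified. -/
structure Extends (O : OpForm L) (n : ℕ) (X X' : Sequent L) : Prop where
  low : Low O n X'
  le : X.S.Le X'.S
  temp : ∀ e, X'.F e = some true → X.F e = some true
  just : ∀ e u, X'.S e = some u → X.S e = some u ∨ X'.S.Sat (FFm O e u)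

theorem Extends.refl (hX : Low O n X) : Extends O n X X :=
  ⟨hX, .refl _, fun _ => id, fun _ _ => Or.inl⟩

theorem Extends.trans (h : Extends O n X X') (h' : Extends O n X' X'') : Extends O n X X'' :=
  ⟨h'.low, h.le.trans h'.le, fun e he => h.temp e (h'.temp e he), fun e u hu =>
    (h'.just e u hu).elim (fun hu => (h.just e u hu).imp_right h'.le.sat) Or.inr⟩

theorem Extends.addUnk (hX : Low O n X) (hn : X.S e = none) (he : e.rk O ≤ Sum.inlₗ n) :
    Extends O n X (X.addUnk e false) where
  low := hX.addUnk he nofun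
  le := Subst.le_set hn _
  temp := fun e' => by
    by_cases hne : e' = e <;> simp [hne, Sequent.addUnk]
  just := fun e' u hu => by
    by_cases hne : e' = e
    · obtain rfl : Val.unk = u := Option.some_inj.1 ((Subst.set_self ..).symm.trans (hne ▸ hu))
      exact Or.inr (Subst.sat_FFm_unk _ _)
    · exact Or.inl ((Subst.set_of_ne hne _ _).symm.trans hu)

theorem Extends.of_addVal {u : ℕ+} (hn : X.S e = none) (h : Extends O n (X.addVal e u) X')
    (hs : X'.S.Sat (FFm O e (.num u))) : Extends O n X X' where
  low := h.low
  le := (Subst.le_set hn _).trans h.le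
  temp := h.temp
  just := fun e' u' hu' => by
    by_cases hne : e' = e
    · have hu := h.le e _ (Subst.set_self ..)
      obtain rfl : Val.num u = u' := Option.some_inj.1 (hu.symm.trans (hne ▸ hu'))
      exact Or.inr (hne ▸ hs)
    · exact (h.just e' u' hu').imp_left (Subst.set_of_ne hne _ _).symm.trans

/-- A sequent `X` with `Low O n X` is `n`-derivable if all those of its extensions are that have the
property `Q`. -/
def Enforces (O : OpForm L) (Cr : Fin (N + 1) → Crit L) (n : ℕ) (Q : Subst L → Prop) : Prop :=
  ∀ X, Low O n X → (∀ X', Extends O n X X' → Q X'.S → RDerivable O Cr (Sum.inlₗ n) X') →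
    RDerivable O Cr (Sum.inlₗ n) X

namespace Enforces

variable {Q Q' : Subst L → Prop}

theorem of_forall (h : ∀ S, Q S) : Enforces O Cr n Q := fun X hX hd => hd X (.refl hX) (h X.S)

theorem mono (h : Enforces O Cr n Q) (hQ : ∀ S, Q S → Q' S) : Enforces O Cr n Q' :=
  fun X hX hd => h X hX fun X' hX' hq => hd X' hX' (hQ _ hq)

theorem bind (h : Enforces O Cr n Q)
    (h' : ∀ S, Q S → Enforces O Cr n fun S' => S.Le S' → Q' S') : Enforces O Cr n Q' :=
  fun X hX hd => h X hX fun X' hX' hq => h' X'.S hq X' hX'.low fun X'' hX'' hq' =>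
    hd X'' (hX'.trans hX'') (hq' hX''.le)

theorem value (he : e.rk O < Sum.inlₗ n)
    (h : ∀ u : ℕ+, Enforces O Cr n fun S => S.Decides (FFm O e (.num u))) :
    Enforces O Cr n fun S => ∃ u ≠ Val.top, S e = some u := by
  intro X hX hd
  have hΩ : e.rk O ≠ Ω := (he.trans (inl_lt_Ω n)).ne
  cases hS : X.S e with
  | some u => exact hd X (.refl hX) ⟨u, fun hu => hX.regular.ne_top e hΩ (hu ▸ hS), hS⟩
  | none =>
    obtain ⟨c, rfl⟩ := exists_eq_term_of_rk_ne_Ω hΩ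
    refine .inf (.cut c X hΩ (Subst.notMem_dom.2 hS)) he ?_
    rintro Θ' (rfl | ⟨u, rfl⟩)
    · exact hd _ (.addUnk hX hS he.le) ⟨.unk, nofun, Subst.set_self ..⟩
    · refine h u _ (hX.addVal he.le hS u) fun X' hX' hdec => ?_
      have hu : X'.S (.term c) = some (.num u) := hX'.le _ _ (Subst.set_self ..)
      rcases hdec with hs | hs
      · exact hd X' (.of_addVal hS hX' hs) ⟨.num u, nofun, hu⟩
      · exact .ax (.axF (Or.inl ⟨_, _, hu, hs⟩))

theorem eval_tuple {k : ℕ} {ts : Fin k → CTm L}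
    (h : ∀ i, Enforces O Cr n fun S => ∃ a, (ts i).eval S = some a) :
    Enforces O Cr n fun S => ∃ a : Fin k → ℕ, ∀ i, (ts i).eval S = some (a i) := by
  induction k with
  | zero => exact of_forall fun _ => ⟨nofun, nofun⟩
  | succ k ih =>
    refine (h 0).bind fun S ⟨a, ha⟩ => (ih fun i => h i.succ).mono fun S' ⟨as, has⟩ hS => ?_
    exact ⟨Fin.cons a as, Fin.cases (hS.evalTm ha) has⟩

theorem eval_term {q : Rank} (hq : q ≤ Sum.inlₗ n)
    (ih : ∀ q' < q, ∀ φ : CFm L, φ.Over {e | e.rk O < q'} →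
      Enforces O Cr n fun S => S.Decides φ) (t : CTm L) (ht : t.Over {e | e.rk O < q}) :
    Enforces O Cr n fun S => ∃ a, t.eval S = some a := by
  induction t with
  | zero => exact of_forall fun _ => ⟨0, rfl⟩
  | succ t iht => exact (iht ht).mono fun S ⟨a, ha⟩ => ⟨a + 1, by simp [CTm.eval, ha]⟩
  | func f ts iht =>
    exact (eval_tuple fun i => iht i (ht i)).mono fun S ⟨a, ha⟩ =>
      ⟨_, by simp only [CTm.eval, seqOpt_eq_some.2 ha]; rfl⟩
  | @sk k φ ts iht =>
    refine (eval_tuple fun i => iht i (ht.2 i)).bind fun S ⟨a, ha⟩ => ?_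
    have hc : (CExpr.term ⟨k, φ, a⟩).rk O < q := ht.1 a
    have hlt := hc.trans_le hq
    refine (value hlt fun u => ih _ hc _ (FFm_term_over (hlt.trans (inl_lt_Ω n)) _)).mono ?_
    rintro S' ⟨u, hu, hS'⟩ hS
    simp only [CTm.eval, seqOpt_eq_some.2 fun i => hS.evalTm (ha i), Option.bind_some, hS']
    cases u with
    | unk => exact ⟨_, rfl⟩
    | num u => exact ⟨_, rfl⟩
    | top => exact absurd rfl hu

theorem decides {q : Rank} (hq : q ≤ Sum.inlₗ n) (φ : CFm L)
    (hφ : φ.Over {e | e.rk O < q}) : Enforces O Cr n fun S => S.Decides φ := by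
  induction q using WellFoundedLT.induction generalizing φ with
  | ind q ih =>
    have ht := eval_term (Cr := Cr) hq fun q' hq' φ => ih q' hq' (hq'.le.trans hq) φ
    simp only [Subst.decides_iff]
    induction φ with
    | eq s t =>
      exact (ht s hφ.1).bind fun S ⟨a, ha⟩ => (ht t hφ.2).mono fun S' ⟨b, hb⟩ hS =>
        ⟨_, by simp only [CFm.eval, hS.evalTm ha, hb]; rfl⟩
    | rel R ts =>
      exact (eval_tuple fun i => ht (ts i) (hφ i)).mono fun S ⟨a, ha⟩ =>
        ⟨_, by simp only [CFm.eval, seqOpt_eq_some.2 ha]; rfl⟩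
    | mem t =>
      have hΩ : Ω < q := hφ.1 0
      exact absurd (hΩ.trans_le hq) (inl_lt_Ω n).not_gt
    | not φ ihφ => exact (ihφ hφ).mono fun S ⟨a, ha⟩ => ⟨_, by simp only [CFm.eval, ha]; rfl⟩
    | and φ ψ ihφ ihψ =>
      exact (ihφ hφ.1).bind fun S ⟨a, ha⟩ => (ihψ hφ.2).mono fun S' ⟨b, hb⟩ hS =>
        ⟨_, by simp only [CFm.eval, hS.evalFm ha, hb]; rfl⟩
    | or φ ψ ihφ ihψ =>
      exact (ihφ hφ.1).bind fun S ⟨a, ha⟩ => (ihψ hφ.2).mono fun S' ⟨b, hb⟩ hS =>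
        ⟨_, by simp only [CFm.eval, hS.evalFm ha, hb]; rfl⟩

end Enforces

end Deciding

section Extensions

variable {X Y : Sequent L} {e : CExpr L}

/-- `Y` extends `X` at most by the expression `e`, whose label may differ. -/
structure ExtendsAt (e : CExpr L) (X Y : Sequent L) : Prop where
  le : X.S.Le Y.S
  S : ∀ e' ≠ e, Y.S e' = X.S e'
  F : ∀ e' ≠ e, Y.F e' = X.F e'

theorem ExtendsAt.refl (e : CExpr L) (X : Sequent L) : ExtendsAt e X X :=
  ⟨.refl _, fun _ _ => rfl, fun _ _ => rfl⟩

theorem ExtendsAt.addUnk (hn : X.S e = none) (i : Bool) : ExtendsAt e X (X.addUnk e i) :=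
  ⟨Subst.le_set hn _, fun _ h => Subst.set_of_ne h _ _, fun _ h => by simp [Sequent.addUnk, h]⟩

theorem ExtendsAt.addVal (hn : X.S e = none) (u : ℕ+) : ExtendsAt e X (X.addVal e u) :=
  ⟨Subst.le_set hn _, fun _ h => Subst.set_of_ne h _ _, fun _ _ => rfl⟩

end Extensions

section Elimination

variable [L.Structure ℕ] {N : ℕ} {Cr : Fin (N + 1) → Crit L} {n : ℕ} {Ψ Ψ' X Y : Sequent L}
  {e : CExpr L} {u : Val}

/-- Whenever the value of `e` is revised in an extension of the part of `Ψ` of rank at most `n`, in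
which only those expressions of `Ψ` are temporary that are so in `X`, the result is derivable. -/
def Revisable (O : OpForm L) (Cr : Fin (N + 1) → Crit L) (n : ℕ) (Ψ X : Sequent L) (e : CExpr L) :
    Prop :=
  ∀ (Y : Sequent L) (v : ℕ+), Low O n Y → Y.S e = some (.num v) →
    Ψ.S.LeOn {e' | e' ≠ e ∧ e'.rk O ≤ Sum.inlₗ n} Y.S →
    (∀ e' ∈ Ψ.S.dom, Y.F e' = some true → X.F e' = some true) →
    (∀ e' u, e' ≠ e → Y.S e' = some u → Y.S.Sat (FFm O e' u)) →
    RDerivable O Cr (Sum.inlₗ n) Y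

theorem Revisable.mono (h : Revisable O Cr n Ψ X e)
    (hΨ : Ψ.S.LeOn {e | e.rk O ≤ Sum.inlₗ n} Ψ'.S)
    (hF : ∀ e ∈ Ψ.S.dom, Y.F e = some true → X.F e = some true) : Revisable O Cr n Ψ' Y e := by
  refine fun Z v hZ hv hle htemp hjust => h Z v hZ hv
    (fun e' he' u hu => hle e' he' u (hΨ e' he'.2 u hu)) (fun e' hd ht => ?_) hjust
  obtain ⟨u, hu⟩ := Option.isSome_iff_exists.1 hd
  exact hF e' hd <| htemp e' (Option.isSome_of_eq_some (hΨ e' (hZ.temp e' ht).le u hu)) ht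

/-- `X` is fit to replace the part of `Ψ` of rank at most `n`, the temporary expressions of `X` that
occur in `Ψ` being revisable. -/
structure Replaces (O : OpForm L) (Cr : Fin (N + 1) → Crit L) (n : ℕ) (Ψ X : Sequent L) : Prop where
  low : Low O n X
  fits : Fits O n Ψ X
  revisable : ∀ e ∈ Ψ.S.dom, X.F e = some true → Revisable O Cr n Ψ X e

namespace Replaces

theorem revisable_of_temp (h : Replaces O Cr n Ψ X)
    (hΨ : Ψ.S.LeOn {e | e.rk O ≤ Sum.inlₗ n} Ψ'.S)
    (hF : ∀ e ∈ Ψ.S.dom, Y.F e = some true → X.F e = some true) (e : CExpr L) (he : e ∈ Ψ.S.dom)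
    (ht : Y.F e = some true) : Revisable O Cr n Ψ' Y e :=
  (h.revisable e he (hF e he ht)).mono hΨ hF

theorem set (h : Replaces O Cr n Ψ X) (hn : Ψ.S e = none) (hΨ' : Ψ'.S = Ψ.S.set e u)
    (hY : Low O n Y) (hXY : ExtendsAt e X Y) (hu : Y.S e = some u)
    (hrev : Y.F e = some true → Revisable O Cr n Ψ' Y e) : Replaces O Cr n Ψ' Y := by
  have hdom {e'} : e' ∈ Ψ'.S.dom ↔ e' = e ∨ e' ∈ Ψ.S.dom := hΨ' ▸ Subst.mem_dom_set
  have hle : Ψ.S.LeOn {e | e.rk O ≤ Sum.inlₗ n} Y.S := fun e' he' u' hu' =>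
    hXY.le e' u' (h.fits.le e' he' u' hu')
  refine ⟨hY, ⟨hΨ' ▸ hle.set hu, fun e' u' hu' => ?_⟩, fun e' he' ht => ?_⟩
  · by_cases hne : e' = e
    · exact Or.inl (hdom.2 (Or.inl hne))
    · exact (h.fits.just e' u' (hXY.S e' hne ▸ hu')).imp (fun hd => hdom.2 (Or.inr hd)) hXY.le.sat
  · obtain rfl | he' := hdom.1 he'
    · exact hrev ht
    · exact h.revisable_of_temp (hΨ' ▸ (Subst.le_set hn u).leOn _)
        (fun e' he' ht => hXY.F e' (Subst.ne_of_mem_dom hn he') ▸ ht) e' he' ht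

theorem addVal {v : ℕ+} (h : Replaces O Cr n Ψ X) (hn : Ψ.S e = none) (hY : Low O n Y)
    (hXY : ExtendsAt e X Y) (hv : Y.S e = some (.num v)) : Replaces O Cr n (Ψ.addVal e v) Y :=
  h.set hn rfl hY hXY hv fun ht => by
    have hunk := hY.regular.unk_of_F (hY.rk_ne_Ω hv) ht
    exact nomatch Option.some_inj.1 (hv.symm.trans hunk)

theorem rDerivable_revise (h : Replaces O Cr n Ψ X) (hd : e ∈ Ψ.S.dom) (ht : X.F e = some true)
    (w : ℕ+) (hc : Ψ.S.Correct O) (hcomp : Ψ.S.Computing O) :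
    RDerivable O Cr (Sum.inlₗ n) (X.revise e w) := by
  have hrk := h.low.temp e ht
  have hlow := h.low.revise hrk.le w
  refine h.revisable e hd ht _ w hlow (Subst.set_self ..) (fun e' he' u hu => ?_)
    (fun e' _ ht' => ?_) fun e' u hne hu => ?_
  · exact (Subst.set_of_ne he'.1 _ _).trans (h.fits.le e' he'.2 u hu)
  · by_cases hne : e' = e
    · exact hne ▸ ht
    · simpa [Sequent.revise, hne] using ht'
  · have hle := hlow.rk_le hu
    obtain ⟨c, rfl⟩ := exists_eq_term_of_rk_ne_Ω (hlow.rk_ne_Ω hu)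
    have huX : X.S (.term c) = some u := (Subst.set_of_ne hne _ _).symm.trans hu
    refine (h.fits.sat_splice h.low hc hcomp ((splice_S_low hle).trans huX)).FFm_of_leOn
      (hle.trans_lt (inl_lt_Ω n)) fun e' (he' : e'.rk O < _) u' hu' => ?_
    have hne' : e' ≠ e := ne_of_apply_ne (CExpr.rk O) (hrk ▸ he'.trans_le hle).ne
    exact (Subst.set_of_ne hne' _ _).trans ((splice_S_low (he'.le.trans hle)).symm.trans hu')

theorem rDerivable_of_hApplies {v : Val} (h : Replaces O Cr n Ψ X) (hΨ : Ψ.Regular O)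
    (he : e.rk O ≤ Sum.inlₗ n) (ha : HApplies O Cr Ψ.S Ψ.P e v) :
    RDerivable O Cr (Sum.inlₗ n) (Ψ.splice O n X) := by
  have hΩ : e.rk O ≠ Ω := (he.trans_lt (inl_lt_Ω n)).ne
  obtain ⟨i, -, hp, -⟩ := ha.main
  obtain ⟨w, rfl⟩ := hp.exists_eq_num hΩ
  have ha' := h.fits.hApplies h.low ha
  have hunk : X.S e = some .unk := h.fits.le e he _ ha.unk
  obtain ⟨b, hb⟩ := Option.isSome_iff_exists.1 ((h.low.regular.domF e).2 ⟨_, hunk, Or.inl rfl⟩)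
  have label : (Ψ.splice O n X).F e = some b := (splice_F_low he).trans hb
  cases b with
  | false => exact .ax (.axH e _ ha' e (active_self ha'.unk nofun) label)
  | true =>
    have hrk := h.low.temp e hb
    refine .inf (.h e _ _ ha' fun e' he' => ?_) hrk.ge ?_
    · rwa [he'.eq (hΨ.splice h.low.regular n) hΩ]
    · rintro Θ' rfl
      rw [h.low.hSeq_splice hΨ hrk w]
      exact h.rDerivable_revise (Option.isSome_of_eq_some ha.unk) hb w ha.correct ha.computing

end Replaces

/-- The cuts of rank `n` can be eliminated above `Ψ`, whatever replaces the part of `Ψ` of rank at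
most `n`. -/
def Eliminable (O : OpForm L) (Cr : Fin (N + 1) → Crit L) (n : ℕ) (Ψ : Sequent L) : Prop :=
  ∀ X, Replaces O Cr n Ψ X → RDerivable O Cr (Sum.inlₗ n) (Ψ.splice O n X)

theorem revisable_addUnk (hΨ : Relation.ReflTransGen (HighStep O Cr n) Sequent.empty Ψ)
    (he : e.rk O = Sum.inlₗ n) (hn : Ψ.S e = none)
    (hX : ∀ e' ∈ Ψ.S.dom, X.F e' = some true → Revisable O Cr n Ψ X e')
    (hV : ∀ v, Eliminable O Cr n (Ψ.addVal e v)) :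
    Revisable O Cr n (Ψ.addUnk e false) X e := by
  intro Y v hY hv hle htemp hjust
  obtain ⟨c, rfl⟩ := exists_eq_term_of_rk_ne_Ω (hY.rk_ne_Ω hv)
  refine Enforces.decides he.le (FFm O (.term c) (.num v))
    (FFm_term_over (he ▸ inl_lt_Ω n) _) Y hY fun Z hZ hdec => ?_
  have hvZ := hZ.le _ _ hv
  rcases hdec with hs | hs
  · have hleZ : Ψ.S.LeOn {e | e.rk O ≤ Sum.inlₗ n} Z.S := fun e' he' u hu =>
      hZ.le _ _ <| hle e' ⟨Subst.ne_of_mem_dom hn (Option.isSome_of_eq_some hu), he'⟩ u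
        (Subst.le_set hn _ _ _ hu)
    have hjustZ : ∀ e' u, Z.S e' = some u → Z.S.Sat (FFm O e' u) := fun e' u hu => by
      by_cases hne : e' = .term c
      · subst hne
        obtain rfl : Val.num v = u := Option.some_inj.1 (hvZ.symm.trans hu)
        exact hs
      · exact (hZ.just e' u hu).elim (fun h => hZ.le.sat (hjust e' u hne h)) id
    have htempZ : ∀ e' ∈ Ψ.S.dom, Z.F e' = some true → X.F e' = some true := fun e' he' ht =>
      htemp e' (Subst.mem_dom_set.2 (Or.inr he')) (hZ.temp e' ht)
    have hΨZ : Replaces O Cr n Ψ Z := ⟨hZ.low, ⟨hleZ, fun e' u hu => Or.inr (hjustZ e' u hu)⟩,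
      fun e' he' ht => (hX e' he' (htempZ e' he' ht)).mono ((Subst.Le.refl _).leOn _) htempZ⟩
    refine rDerivable_of_path hΨ hZ.low hleZ hjustZ ?_
    rw [← splice_addVal_low he.le v]
    exact hV v Z (hΨZ.addVal hn hZ.low (.refl _ _) hvZ)
  · exact .ax (.axF (Or.inl ⟨_, _, hvZ, hs⟩))

namespace Eliminable

theorem of_isAxiom (hΨ : Ψ.Regular O) (ha : IsAxiom O Cr Ψ) : Eliminable O Cr n Ψ := by
  intro X hX
  have hle := leOn_splice hX.fits.le
  cases ha with
  | axF ha => exact .ax (.axF (ha.mono hle))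
  | axS ha hdec =>
    exact .ax (.axS (fun i => (Subst.le_ext _).sat (hle.sat (ha.sat hdec i)))
      fun i => hle.decides (hdec i))
  | axH e v ha e' active fixed =>
    rcases le_or_gt (e.rk O) (Sum.inlₗ n) with he | he
    · exact hX.rDerivable_of_hApplies hΨ he ha
    · exact .ax (.axH e v (hX.fits.hApplies hX.low ha) e'
        ((active_splice hΨ hX.low.regular he).2 active)
        ((splice_F_high (active.2.1 ▸ he)).trans fixed))

theorem of_step (hΨ : Ψ.Regular O) (hstep : HighStep O Cr n Ψ Ψ')
    (hS : ∀ e, e.rk O ≤ Sum.inlₗ n → Ψ'.S e = Ψ.S e) (h : Eliminable O Cr n Ψ') :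
    Eliminable O Cr n Ψ := by
  intro X hX
  have hdom {e : CExpr L} (he : e.rk O ≤ Sum.inlₗ n) : e ∈ Ψ'.S.dom ↔ e ∈ Ψ.S.dom := by
    simp [Subst.dom, hS e he]
  refine hstep.rDerivable_splice hΨ hX.low hX.fits (h X ⟨hX.low, ⟨fun e he u hu => ?_,
    fun e u hu => ?_⟩, fun e he ht => ?_⟩)
  · exact hX.fits.le e he u (hS e he ▸ hu)
  · exact (hX.fits.just e u hu).imp_left (hdom (hX.low.rk_le hu)).2
  · exact hX.revisable_of_temp (hstep.leOn hΨ) (fun _ _ => id) e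
      ((hdom (hX.low.temp e ht).le).1 he) ht

theorem of_cut {c : CanTerm L} (hΨ : Relation.ReflTransGen (HighStep O Cr n) Sequent.empty Ψ)
    (hn : Ψ.S (.term c) = none) (he : (CExpr.term c).rk O ≤ Sum.inlₗ n)
    (hU : Eliminable O Cr n (Ψ.addUnk (.term c) false))
    (hV : ∀ v, Eliminable O Cr n (Ψ.addVal (.term c) v)) : Eliminable O Cr n Ψ := by
  intro X hX
  have derivable_of_unk (Y) (hY : Low O n Y) (hXY : ExtendsAt (.term c) X Y)
      (hu : Y.S (.term c) = some .unk) : RDerivable O Cr (Sum.inlₗ n) (Ψ.splice O n Y) := by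
    rw [← splice_addUnk_low he false]
    refine hU Y (hX.set hn rfl hY hXY hu fun ht => revisable_addUnk hΨ (hY.temp _ ht) hn ?_ hV)
    exact hX.revisable_of_temp ((Subst.Le.refl _).leOn _) fun e he ht =>
      hXY.F e (Subst.ne_of_mem_dom hn he) ▸ ht
  have derivable_of_num (Y) (u : ℕ+) (hY : Low O n Y) (hXY : ExtendsAt (.term c) X Y)
      (hu : Y.S (.term c) = some (.num u)) : RDerivable O Cr (Sum.inlₗ n) (Ψ.splice O n Y) := by
    rw [← splice_addVal_low he u]
    exact hV u Y (hX.addVal hn hY hXY hu)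
  have hΩ : (CExpr.term c).rk O ≠ Ω := (he.trans_lt (inl_lt_Ω n)).ne
  match hXc : X.S (.term c) with
  | some .unk => exact derivable_of_unk X hX.low (.refl _ _) hXc
  | some (.num u) => exact derivable_of_num X u hX.low (.refl _ _) hXc
  | some .top => exact absurd hXc (hX.low.regular.ne_top _ hΩ)
  | none =>
    have hfresh : CExpr.term c ∉ (Ψ.splice O n X).S.dom := by
      rwa [Subst.notMem_dom, splice_S_low he]
    have derivable_addUnk (i : Bool) (hi : i = true → (CExpr.term c).rk O = Sum.inlₗ n) :
        RDerivable O Cr (Sum.inlₗ n) ((Ψ.splice O n X).addUnk (.term c) i) := by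
      rw [← splice_addUnk_right he]
      exact derivable_of_unk _ (hX.low.addUnk he hi) (.addUnk hXc i) (Subst.set_self ..)
    rcases lt_or_eq_of_le he with hlt | heq
    · refine .inf (.cut c _ hΩ hfresh) hlt ?_
      rintro Θ' (rfl | ⟨u, rfl⟩)
      · exact derivable_addUnk false nofun
      · dsimp only
        rw [← splice_addVal_right he]
        exact derivable_of_num _ u (hX.low.addVal he hXc u) (.addVal hXc u) (Subst.set_self ..)
    · exact .inf (.fr _ _ hfresh) heq.ge fun Θ' hΘ' => hΘ' ▸ derivable_addUnk true fun _ => heq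

end Eliminable

namespace RDerivable

theorem eliminable (hd : RDerivable O Cr (Sum.inlₗ (n + 1)) Ψ)
    (hΨ : Relation.ReflTransGen (HighStep O Cr n) Sequent.empty Ψ) : Eliminable O Cr n Ψ := by
  induction hd with
  | ax ha => exact .of_isAxiom (regular_of_path hΨ) ha
  | @inf K e Ψ Pr hi hK _ ih =>
    have hreg := regular_of_path hΨ
    have hK' : RuleBound (· ≤ Sum.inlₗ n) (Sum.inlₗ n < ·) K (e.rk O) :=
      hK.mono (fun _ => lt_inl_succ.1) fun _ => inl_succ_le.1
    have hstep Ψ' (hΨ' : Ψ' ∈ Pr) : HighStep O Cr n Ψ Ψ' := hi.highStep hK' hΨ'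
    have premise Ψ' (hΨ' : Ψ' ∈ Pr) : Eliminable O Cr n Ψ' :=
      ih Ψ' hΨ' (hΨ.tail (hstep Ψ' hΨ'))
    cases hi with
    | cut c Θ hr hc =>
      exact .of_cut hΨ (Subst.notMem_dom.1 hc) hK' (premise _ (Or.inl rfl)) fun v =>
        premise _ (Or.inr ⟨v, rfl⟩)
    | cutFr => exact hK.elim
    | cutTerm c Θ hr => exact absurd (hr ▸ hK') (inl_lt_Ω n).not_ge
    | cutFrTerm => exact hK.elim
    | cutForm m => exact absurd hK' (inl_lt_Ω n).not_ge
    | fr e Θ he =>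
      refine .of_step hreg (hstep _ rfl) (fun e' he' => Subst.set_of_ne ?_ _ _) (premise _ rfl)
      exact ne_of_apply_ne (CExpr.rk O) (he'.trans_lt hK').ne
    | h e v Θ =>
      exact .of_step hreg (hstep _ rfl) (fun e' he' => hData_S_low hreg hK' he') (premise _ rfl)

theorem reduce (hd : RDerivable O Cr (Sum.inlₗ (n + 1)) Ψ)
    (hΨ : Relation.ReflTransGen (HighStep O Cr n) Sequent.empty Ψ) :
    RDerivable O Cr (Sum.inlₗ n) Ψ := by
  have fixed := fixed_of_path hΨ
  have low := (regular_of_path hΨ).low_splice_empty fixed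
  have fits : Fits O n Ψ (Sequent.empty.splice O n Ψ) :=
    ⟨fun e he u hu => (splice_S_low he).trans hu, fun e u hu =>
      Or.inl (Option.isSome_of_eq_some ((splice_S_low (low.rk_le hu)).symm.trans hu))⟩
  have h := hd.eliminable hΨ _ ⟨low, fits, fun e _ ht =>
    have hle := (low.temp e ht).le
    absurd ((splice_F_low hle).symm.trans ht) (fixed e hle)⟩
  rwa [Sequent.splice_splice_empty, Sequent.splice_self] at h

theorem reduce_of_le {m : ℕ} (h : n ≤ m) (hd : RDerivable O Cr (Sum.inlₗ m) Ψ)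
    (hΨ : Relation.ReflTransGen (PathStep O Cr (Sum.inlₗ n)) Sequent.empty Ψ) :
    RDerivable O Cr (Sum.inlₗ n) Ψ := by
  induction m, h using Nat.le_induction with
  | base => exact hd
  | succ m h ih => exact ih (hd.reduce (hΨ.lift id fun _ _ => PathStep.highStep h))

theorem reduce_of_Ω (hd : RDerivable O Cr Ω Ψ)
    (hΨ : Relation.ReflTransGen (PathStep O Cr (Sum.inlₗ n)) Sequent.empty Ψ) :
    RDerivable O Cr (Sum.inlₗ n) Ψ := by
  induction hd generalizing n with
  | ax ha => exact .ax ha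
  | @inf K e Ψ Pr hi hK _ ih =>
    have premise {m : ℕ} (hnm : n ≤ m) (hK' : RuleBound (· ≤ Sum.inlₗ m) (Ω ≤ ·) K (e.rk O))
        (Ψ' : Sequent L) (hΨ' : Ψ' ∈ Pr) : RDerivable O Cr (Sum.inlₗ m) Ψ' :=
      ih Ψ' hΨ' <| (hΨ.lift id fun _ _ => PathStep.mono (Sum.Lex.inl_le_inl_iff.2 hnm)).tail
        (hi.pathStep hK' hΨ')
    cases K with
    | cut =>
      obtain ⟨m, hm⟩ := exists_eq_inl_of_lt_Ω hK
      rcases lt_or_ge m n with h | h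
      · have hlt : e.rk O < Sum.inlₗ n := hm ▸ Sum.Lex.inl_lt_inl_iff.2 h
        exact .inf hi hlt (premise le_rfl hlt.le)
      · have hlt : e.rk O < Sum.inlₗ (m + 1) := lt_inl_succ.2 hm.le
        have hle : n ≤ m + 1 := h.trans m.le_succ
        exact reduce_of_le hle (.inf hi hlt (premise hle hlt.le)) hΨ
    | cutFr => exact hK.elim
    | fr => exact .inf hi ((inl_lt_Ω n).le.trans hK) (premise le_rfl hK)
    | h => exact .inf hi ((inl_lt_Ω n).le.trans hK) (premise le_rfl hK)

end RDerivable

end Elimination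

end EpsID

theorem mainTheorem5 (L : FirstOrder.Language.{0, 0}) [L.Structure ℕ] (O : EpsID.OpForm L)
    (N : ℕ) (Cr : Fin (N + 1) → EpsID.Crit L) (r : EpsID.Rank) (hr : r ≤ EpsID.Ω)
    (Θ : EpsID.Sequent L) (hseq : Θ.IsSequent O) (d : EpsID.Derivation O Cr Θ)
    (hd : d.IsRDeduction EpsID.Ω)
    (hΘ : EpsID.HasPath O Cr r Θ) :
    ∃ d' : EpsID.Derivation O Cr Θ, d'.IsRDeduction r := by
  rcases lt_or_eq_of_le hr with h | rfl
  · obtain ⟨n, rfl⟩ := EpsID.exists_eq_inl_of_lt_Ω h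
    exact (hd.rDerivable.reduce_of_Ω hΘ.reflTransGen).exists_derivation
  · exact ⟨d, hd⟩
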